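/- **Setting.** Let $A$ be a ring, $R\subseteq A$ a left Noetherian subring, and $x_1,\dots,x_n\in A\setminus R$ such that $A$ is a $\sigma$-PBW extension of $R$: the standard monomials $x^\alpha=x_1^{\alpha_1}\cdots x_n^{\alpha_n}$, $\alpha\in\mathbb N^n$, form a basis of $A$ as a left $R$-module; for all $i$ and $0\ne r\in R$ there is $0\neq c_{i,r}\in R$ with $x_ir-c_{i,r}x_i\in R$; for all $i,j$ there is $0\ne c_{i,j}\in R$ with $x_jx_i-c_{i,j}x_ix_j\in R+Rx_1+\dots+Rx_n$. Let $\sigma_i:R\to R$ be the map with $x_ir-\sigma_i(r)x_i\in R$ for all $r \in R$, $\sigma^\alpha=\sigma_1^{\alpha_1}\cdots\sigma_n^{\alpha_n}$, and let $c_{\alpha,\beta}\in R$ be the coefficient of $x^{\alpha+\beta}$ in $x^\alpha x^\beta$. Assume that $A$ is quasi-commutative (one always has $x_ir=c_{i,r}x_i$ and $x_jx_i=c_{i,j}x_ix_j$ with such nonzero $c_{i,r},c_{i,j}$) and bijective (all $\sigma_i$ are bijective and $c_{i,j}$ is invertible in $R$ for $i<j$). Fix a monomial order on $\mathrm{Mon}(A)=\{x^\alpha\}$,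 i.e. a total order with $x^\alpha\succeq 1$, with $|\beta|>|\alpha|\Rightarrow x^\beta\succ x^\alpha$, and with $x^\beta\succeq x^\alpha\Rightarrow lm(x^\gamma x^\beta x^\lambda)\succeq lm(x^\gamma x^\alpha x^\lambda)$. Fix a monomial order on the set of monomials $x^\alpha e_u$ ($\alpha \in \mathbb N^n$, $1\le u\le m$) of the left module $A^m$, i.e. a total order with $lm(x^\beta x^\alpha)e_u\succeq x^\alpha e_u$, with $x^\beta e_v\succeq x^\alpha e_u\Rightarrow lm(x^\gamma x^\beta)e_v\succeq lm(x^\gamma x^\alpha)e_u$, and with $|\beta|>|\alpha|\Rightarrow x^\beta e_v\succ x^\alpha e_u$. Write $lm(f)$, $lc(f)$ for leading monomial and leading coefficient. For a finite set $F$ of nonzero vectors, $0\neq f\in A^m$ with $lm(f)=x^\delta e_u$ *reduces in one step by $F$* to $h$ if there are $f_1,\dots,f_t\in F$ with $lm(f_i)=x^{\beta_i}e_u$, $\alpha_i\in\mathbb N^n$ with $\alpha_i+\beta_i=\delta$, and $r_i\in R$ such that $lc(f)=\sum_i r_i\sigma^{\alpha_i}(lc(f_i))c_{\alpha_i,\beta_i}$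 and $h=f-\sum_i r_ix^{\alpha_i}f_i$. A vector is *reduced w.r.t. $F$* if it is $0$ or admits no one-step reduction by $F$. A nonempty finite set $G$ of nonzero vectors of a submodule $M\neq0$ of $A^m$ is a *Gröbner basis* of $M$ if no nonzero element of $M$ is reduced w.r.t. $G$ (and $\{0\}$ is the Gröbner basis of $M=0$). For a finite nonempty set $S\subseteq A^m$ of nonzero vectors write $X_S\ne0$ if the leading monomials $x^{\beta_g}e_u$ of all $g\in S$ have the same index $u$; then $X_S=x^\delta e_u$ with $\delta$ the componentwise maximum of the $\beta_g$; put $\gamma_g=\delta-\beta_g$, and let $B_S$ denote a finite generating set of the left $R$-module of all $(b_g)_{g\in S}\in R^S$ with $\sum_g b_g\,\sigma^{\gamma_g}(lc(g))\,c_{\gamma_g,\beta_g}=0$. **Algorithm.** Input: a nonempty finite set $F=\{f_1,\dots,f_s\}$ of nonzero vectors of $A^m$. Set $G:=\emptyset$, $G':=F$. While $G'\ne G$: put $D:=P(G')\setminus P(G)$ (with $P$ the power set) and $G:=G'$; for each $S\in D$ with $X_S\neq0$, choose a $B_S$, and for each $b\in B_S$ reduce the S-vector $\sum_{g\in S}b_gx^{\gamma_g}g$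 by successive one-step reductions by the current $G'$ until a vector $r$ that is reduced w.r.t. $G'$ is reached; if $r\neq0$, put $G':=G'\cup\{r\}$. Output $G$. **Claim.** The algorithm is correct: for every order in which the for-loops are executed, every choice of the finite generating sets $B_S$ and every choice of the one-step reductions, the run terminates (it is finite, and it never stops before the condition $G'\neq G$ of the while-loop fails), and its output $G$ is a Gröbner basis of the submodule $\langle f_1,\dots,f_s\rangle\subseteq A^m$. -/

import Mathlib

noncomputable section

namespace SkewPBW

/-- Exponents `α ∈ ℕⁿ`. -/
abbrev Expo (n : ℕ) : Type := Fin n → ℕ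

/-- The total degree `|α| = α₁ + ⋯ + αₙ`. -/
def Expo.deg {n : ℕ} (α : Expo n) : ℕ := ∑ i, α i

/-- The standard monomial `x^α = x₁^α₁ ⋯ xₙ^αₙ`, the factors multiplied in this order. -/
def stdMonomial {A : Type*} [Ring A] {n : ℕ} (x : Fin n → A) (α : Expo n) : A :=
  (List.ofFn fun i => x i ^ α i).prod

/-- The (exponents of the) monomials `x^α e_u` of `A^m`. -/
abbrev VMon (n m : ℕ) : Type := Expo n × Fin m

/-- `A` is a `σ`-PBW extension (skew PBW extension) of its subring `R`, with variables
`x₁, …, xₙ`: the standard monomials form a basis of `A` as a left `R`-module, and the two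
commutation rules hold. -/
structure Extension {A : Type*} [Ring A] (R : Subring A) (n : ℕ) where
  x : Fin n → A
  x_notMem : ∀ i, x i ∉ R
  linearIndependent : LinearIndependent R (stdMonomial x)
  span_eq_top : ⊤ ≤ Submodule.span R (Set.range (stdMonomial x))
  var_mul_coeff : ∀ (i : Fin n) (r : R), r ≠ 0 →
    ∃ c : R, c ≠ 0 ∧ x i * (r : A) - (c : A) * x i ∈ R
  var_mul_var : ∀ i j : Fin n, ∃ c : R, c ≠ 0 ∧
    x j * x i - (c : A) * (x i * x j) ∈ Submodule.span R (insert 1 (Set.range x))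

namespace Extension

variable {A : Type*} [Ring A] {R : Subring A} {n m : ℕ}

/-- `x^α`. -/
def mon (E : Extension R n) (α : Expo n) : A := stdMonomial E.x α

/-- The basis `Mon(A)` of the left `R`-module `A`. -/
def basis (E : Extension R n) : Module.Basis (Expo n) R A :=
  Module.Basis.mk E.linearIndependent E.span_eq_top

/-- The coefficient of `x^α` in `f`. -/
def coeff (E : Extension R n) (f : A) (α : Expo n) : R := E.basis.repr f α

/-- The map `σ_i : R → R`, characterized by `x_i r = σ_i(r) x_i + δ_i(r)` with `δ_i(r) ∈ R`:
`σ_i(r)` is the coefficient of `x_i` in `x_i r`. -/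
def sigma (E : Extension R n) (i : Fin n) (r : R) : R :=
  E.coeff (E.x i * (r : A)) (Pi.single i 1)

/-- `σ^α = σ₁^α₁ ∘ ⋯ ∘ σₙ^αₙ`. -/
def sigmaPow (E : Extension R n) (α : Expo n) : R → R :=
  (List.ofFn fun i => (E.sigma i)^[α i]).foldr (fun f g => f ∘ g) id

/-- `c_{α,β}`, the coefficient of `x^{α+β}` in `x^α x^β`. -/
def cc (E : Extension R n) (α β : Expo n) : R := E.coeff (E.mon α * E.mon β) (α + β)

/-- Quasi-commutative: `x_i r = c_{i,r} x_i` and `x_j x_i = c_{i,j} x_i x_j`. -/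
structure IsQuasiCommutative (E : Extension R n) : Prop where
  var_mul_coeff : ∀ (i : Fin n) (r : R), r ≠ 0 →
    ∃ c : R, c ≠ 0 ∧ E.x i * (r : A) = (c : A) * E.x i
  var_mul_var : ∀ i j : Fin n, ∃ c : R, c ≠ 0 ∧ E.x j * E.x i = (c : A) * (E.x i * E.x j)

/-- Bijective: every `σ_i` is bijective and every `c_{i,j}`, `i < j`, is invertible in `R`. -/
structure IsBijective (E : Extension R n) : Prop where
  sigma_bijective : ∀ i, Function.Bijective (E.sigma i)
  isUnit_of_lt : ∀ i j : Fin n, i < j → ∀ c : R,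
    E.x j * E.x i - (c : A) * (E.x i * E.x j) ∈
      Submodule.span R (insert 1 (Set.range E.x)) → IsUnit c

/-- `α` is the exponent of the leading monomial of `f ∈ A` (in particular `f ≠ 0`). -/
def IsLM (E : Extension R n) (le₀ : Expo n → Expo n → Prop) (f : A) (α : Expo n) : Prop :=
  E.coeff f α ≠ 0 ∧ ∀ β, E.coeff f β ≠ 0 → le₀ β α

/-- Monomial orders on `Mon(A)`; `le₀ α β` means `x^α ⪯ x^β`. -/
structure IsMonomialOrder (E : Extension R n) (le₀ : Expo n → Expo n → Prop) : Prop where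
  refl : ∀ α, le₀ α α
  trans : ∀ α β γ, le₀ α β → le₀ β γ → le₀ α γ
  antisymm : ∀ α β, le₀ α β → le₀ β α → α = β
  total : ∀ α β, le₀ α β ∨ le₀ β α
  mul : ∀ α β γ κ, le₀ α β → ∀ μ ν,
    E.IsLM le₀ (E.mon γ * E.mon α * E.mon κ) μ →
    E.IsLM le₀ (E.mon γ * E.mon β * E.mon κ) ν → le₀ μ ν
  one_le : ∀ α, le₀ 0 α
  deg : ∀ α β, α.deg < β.deg → le₀ α β

/-- Monomial orders on `Mon(A^m)`; `le X Y` means `X ⪯ Y`. -/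
structure IsVMonomialOrder (E : Extension R n) (le₀ : Expo n → Expo n → Prop)
    (le : VMon n m → VMon n m → Prop) : Prop where
  refl : ∀ X, le X X
  trans : ∀ X Y Z, le X Y → le Y Z → le X Z
  antisymm : ∀ X Y, le X Y → le Y X → X = Y
  total : ∀ X Y, le X Y ∨ le Y X
  le_mul : ∀ (α β : Expo n) (u : Fin m) (μ : Expo n),
    E.IsLM le₀ (E.mon β * E.mon α) μ → le (α, u) (μ, u)
  mul : ∀ (α β γ : Expo n) (u v : Fin m), le (α, u) (β, v) → ∀ μ ν,
    E.IsLM le₀ (E.mon γ * E.mon α) μ → E.IsLM le₀ (E.mon γ * E.mon β) ν → le (μ, u) (ν, v)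
  deg : ∀ (α β : Expo n) (u v : Fin m), α.deg < β.deg → le (α, u) (β, v)

/-- The coefficient of the monomial `X = x^α e_u` in `f ∈ A^m`. -/
def vcoeff (E : Extension R n) (f : Fin m → A) (X : VMon n m) : R := E.coeff (f X.2) X.1

/-- `X` is the leading monomial of `f ∈ A^m` (in particular `f ≠ 0`); the leading coefficient
of `f` is then `E.vcoeff f X`. -/
def IsVLM (E : Extension R n) (le : VMon n m → VMon n m → Prop) (f : Fin m → A)
    (X : VMon n m) : Prop :=
  E.vcoeff f X ≠ 0 ∧ ∀ Y, E.vcoeff f Y ≠ 0 → le Y X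

/-- `f` reduces to `h` by `F` in one step: for some `f₁, …, f_t ∈ F` whose leading monomials
`x^{β_i} e_u` divide the leading monomial `x^δ e_u` of `f`, with `α_i + β_i = δ`, and some
`r_i ∈ R`, one has `lc(f) = ∑ r_i σ^{α_i}(lc(f_i)) c_{α_i,β_i}` and
`h = f - ∑ r_i x^{α_i} f_i`. By convention `0` reduces to `0`. -/
def ReducesStep (E : Extension R n) (le : VMon n m → VMon n m → Prop)
    (F : Finset (Fin m → A)) (f h : Fin m → A) : Prop :=
  (f = 0 ∧ h = 0) ∨
  ∃ (δ : Expo n) (u : Fin m), E.IsVLM le f (δ, u) ∧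
    ∃ (t : ℕ) (g : Fin t → Fin m → A) (r : Fin t → R) (α β : Fin t → Expo n),
      (∀ i, g i ∈ F) ∧ (∀ i, E.IsVLM le (g i) (β i, u)) ∧ (∀ i, α i + β i = δ) ∧
      E.vcoeff f (δ, u) =
        ∑ i, r i * E.sigmaPow (α i) (E.vcoeff (g i) (β i, u)) * E.cc (α i) (β i) ∧
      h = f - ∑ i, ((r i : A) * E.mon (α i)) • g i

/-- `f` is reduced w.r.t. `F`: `f = 0` or no one-step reduction of `f` by `F` exists. -/
def IsReduced (E : Extension R n) (le : VMon n m → VMon n m → Prop)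
    (F : Finset (Fin m → A)) (f : Fin m → A) : Prop :=
  f = 0 ∨ ¬ ∃ h, E.ReducesStep le F f h

/-- `G` is a Gröbner basis of the submodule `M` of `A^m`. -/
def IsGroebnerBasis (E : Extension R n) (le : VMon n m → VMon n m → Prop)
    (M : Submodule A (Fin m → A)) (G : Finset (Fin m → A)) : Prop :=
  (M = ⊥ ∧ G = {0}) ∨
  (M ≠ ⊥ ∧ G.Nonempty ∧ (∀ g ∈ G, g ∈ M ∧ g ≠ 0) ∧
    ∀ f ∈ M, f ≠ 0 → ¬ E.IsReduced le G f)

/-- The data attached to `S ⊆ A^m` with `X_S ≠ 0`: all leading monomials of elements of `S` have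
the same index `u`, the exponent of `lm(g)` is `β g`, so that `X_S = x^δ e_u` with `δ` the
componentwise maximum of the `β g`, and `γ g + β g = δ`. -/
structure LcmData (E : Extension R n) (le : VMon n m → VMon n m → Prop)
    (S : Finset (Fin m → A)) (u : Fin m) (β γ : S → Expo n) : Prop where
  lead : ∀ g : S, E.IsVLM le (g : Fin m → A) (β g, u)
  add : ∀ g : S, γ g + β g = Finset.univ.sup β

/-- `X_S ≠ 0`. -/
def LcmNeZero (E : Extension R n) (le : VMon n m → VMon n m → Prop)
    (S : Finset (Fin m → A)) : Prop :=
  ∃ (u : Fin m) (β γ : S → Expo n), E.LcmData le S u β γ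

/-- The left `R`-module `Syz_R[σ^{γ_g}(lc(g)) c_{γ_g,β_g}]_{g ∈ S}` of all `(b_g)_{g ∈ S}` with
`∑ b_g σ^{γ_g}(lc(g)) c_{γ_g,β_g} = 0`. -/
def syz (E : Extension R n) (S : Finset (Fin m → A)) (u : Fin m) (β γ : S → Expo n) :
    Submodule R (S → R) :=
  LinearMap.ker (Fintype.linearCombination R fun g : S =>
    E.sigmaPow (γ g) (E.vcoeff (g : Fin m → A) (β g, u)) * E.cc (γ g) (β g))

/-- The S-vector `∑_{g ∈ S} b_g x^{γ_g} g`. -/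
def sVector (E : Extension R n) (S : Finset (Fin m → A)) (γ : S → Expo n) (b : S → R) :
    Fin m → A :=
  ∑ g : S, ((b g : A) * E.mon (γ g)) • (g : Fin m → A)

/-- The states of the algorithm. `G` and `G'` are its two variables, `D` holds the sets `S` still
to be treated by the outer FOR loop, `B` the syzygies still to be treated by the inner one.
* `test G G'`: about to test the condition `G' ≠ G` of the WHILE loop;
* `sets G G' D`: in the outer FOR loop;
* `vectors G G' D S γ B`: in the inner FOR loop, for the set `S`;
* `reducing G G' D S γ B h`: the current S-vector has been reduced to `h` so far. -/
inductive State (R : Subring A) (n m : ℕ) where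
  | test (G G' : Finset (Fin m → A)) : State R n m
  | sets (G G' : Finset (Fin m → A)) (D : Finset (Finset (Fin m → A))) : State R n m
  | vectors (G G' : Finset (Fin m → A)) (D : Finset (Finset (Fin m → A)))
      (S : Finset (Fin m → A)) (γ : S → Expo n) (B : Finset (S → R)) : State R n m
  | reducing (G G' : Finset (Fin m → A)) (D : Finset (Finset (Fin m → A)))
      (S : Finset (Fin m → A)) (γ : S → Expo n) (B : Finset (S → R)) (h : Fin m → A) :
      State R n m

open scoped Classical in
/-- One step of the algorithm. Every choice that the algorithm leaves open (the order in which the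
FOR loops run, the finite generating set `B_S`, the one-step reductions) is left open here. -/
inductive Step (E : Extension R n) (le : VMon n m → VMon n m → Prop) :
    State R n m → State R n m → Prop
  /- WHILE `G' ≠ G` DO `D := P(G') - P(G)`, `G := G'` -/
  | enter (G G' : Finset (Fin m → A)) (hne : G' ≠ G) :
      Step E le (.test G G') (.sets G' G' (G'.powerset \ G.powerset))
  /- sets `S ∈ D` with `X_S = 0` are skipped -/
  | skip (G G' : Finset (Fin m → A)) (D : Finset (Finset (Fin m → A)))
      (S : Finset (Fin m → A)) (hS : S ∈ D) (hX : ¬ E.LcmNeZero le S) :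
      Step E le (.sets G G' D) (.sets G G' (D.erase S))
  /- for `S ∈ D` with `X_S ≠ 0`, a finite generating set `B` of the syzygy module is computed -/
  | compute (G G' : Finset (Fin m → A)) (D : Finset (Finset (Fin m → A)))
      (S : Finset (Fin m → A)) (hS : S ∈ D) (u : Fin m) (β γ : S → Expo n)
      (hX : E.LcmData le S u β γ) (B : Finset (S → R))
      (hB : Submodule.span R (B : Set (S → R)) = E.syz S u β γ) :
      Step E le (.sets G G' D) (.vectors G G' (D.erase S) S γ B)
  /- the outer FOR loop is finished -/
  | leave (G G' : Finset (Fin m → A)) : Step E le (.sets G G' ∅) (.test G G')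
  /- the next `b ∈ B_S`: start to reduce its S-vector -/
  | choose (G G' : Finset (Fin m → A)) (D : Finset (Finset (Fin m → A)))
      (S : Finset (Fin m → A)) (γ : S → Expo n) (B : Finset (S → R)) (b : S → R) (hb : b ∈ B) :
      Step E le (.vectors G G' D S γ B) (.reducing G G' D S γ (B.erase b) (E.sVector S γ b))
  /- a one-step reduction by `G'` of a vector that is not yet reduced w.r.t. `G'` -/
  | reduce (G G' : Finset (Fin m → A)) (D : Finset (Finset (Fin m → A)))
      (S : Finset (Fin m → A)) (γ : S → Expo n) (B : Finset (S → R)) (h h' : Fin m → A)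
      (hred : ¬ E.IsReduced le G' h) (hstep : E.ReducesStep le G' h h') :
      Step E le (.reducing G G' D S γ B h) (.reducing G G' D S γ B h')
  /- the remainder is zero -/
  | discard (G G' : Finset (Fin m → A)) (D : Finset (Finset (Fin m → A)))
      (S : Finset (Fin m → A)) (γ : S → Expo n) (B : Finset (S → R)) :
      Step E le (.reducing G G' D S γ B 0) (.vectors G G' D S γ B)
  /- the remainder `r` is not zero: `G' := G' ∪ {r}` -/
  | add (G G' : Finset (Fin m → A)) (D : Finset (Finset (Fin m → A)))
      (S : Finset (Fin m → A)) (γ : S → Expo n) (B : Finset (S → R)) (r : Fin m → A)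
      (hred : E.IsReduced le G' r) (hr : r ≠ 0) :
      Step E le (.reducing G G' D S γ B r) (.vectors G (insert r G') D S γ B)
  /- the inner FOR loop is finished -/
  | next (G G' : Finset (Fin m → A)) (D : Finset (Finset (Fin m → A)))
      (S : Finset (Fin m → A)) (γ : S → Expo n) :
      Step E le (.vectors G G' D S γ ∅) (.sets G G' D)

/-- The state after the initialization `G := ∅`, `G' := F`. -/
def State.start (R : Subring A) (n : ℕ) (F : Finset (Fin m → A)) : State R n m := .test ∅ F

end Extension

end SkewPBW

end

/-! The argument is Buchberger's, with left ideals of `R` in place of single leading coefficients.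

In the quasi-commutative bijective case every `c_{α,β}` is a unit, every `σ^α` is an automorphism of
`R`, and multiplication by `x^α` sends distinct monomials to distinct monomials (`coeff_mon_mul`).
So `lm(x^α g) = x^α lm(g)`, up to a unit of `R`, and cancellation is easy to track.

The bookkeeping device is `filt`: the `R`-span of those multiples `x^α g`, `g ∈ G`, whose leading
monomial satisfies a condition. A one-step reduction of `f` is the subtraction of an element of
`filt` concentrated at `lm(f)` with the same leading coefficient (`reducesStep_iff`).

Correctness: call `S ⊆ G` treated if each of its S-vectors is a combination of multiples with
leading monomials strictly below `X_S`. A combination of multiples up to `X` whose coefficient at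
`X` vanishes has as top part a multiple `x^θ` of an S-vector of some `S ⊆ G`; here the invertibility
of `σ^θ` and of the `c_{θ,γ}` is used. If all `S` are treated, that part can be rewritten below `X`.
Descending along the well-founded order yields a combination whose bound is `lm(f)`, whose top part
reduces `f` (`not_isReduced_of_treated`). The loop invariant shows that all subsets of the output
are treated.

Termination: in an infinite run that keeps adding remainders, Dickson's lemma extracts remainders
whose leading monomials successively divide one another. Their leading coefficients, normalised by
`σ^{-β}`, generate an ascending chain of left ideals, which stabilises; then some remainder was
reducible when added (`wellFounded_augments`). Between two additions a lexicographic rank in natural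
numbers decreases (`rank_step`). -/

namespace SkewPBW

/-! ### Products of standard monomials up to units of `R` -/

section Monomials

variable {A : Type*} [Ring A] {R : Subring A} {n : ℕ}

theorem stdMonomial_zero_vars (x : Fin 0 → A) (α : Expo 0) : stdMonomial x α = 1 := by
  simp [stdMonomial]

theorem stdMonomial_succ (x : Fin (n + 1) → A) (α : Expo (n + 1)) :
    stdMonomial x α = x 0 ^ α 0 * stdMonomial (fun i => x i.succ) (fun i => α i.succ) := by
  simp [stdMonomial, List.ofFn_succ]

theorem stdMonomial_zero (x : Fin n → A) : stdMonomial x 0 = 1 := by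
  induction n with
  | zero => exact stdMonomial_zero_vars _ _
  | succ n ih => rw [stdMonomial_succ, Pi.zero_apply, pow_zero, one_mul]; exact ih _

theorem stdMonomial_single (x : Fin n → A) (i : Fin n) :
    stdMonomial x (Pi.single i 1) = x i := by
  induction n with
  | zero => exact i.elim0
  | succ n ih =>
    rw [stdMonomial_succ]
    refine Fin.cases ?_ (fun j => ?_) i
    · have : (fun k : Fin n => (Pi.single (0 : Fin (n + 1)) 1 : Expo (n + 1)) k.succ) = 0 := by
        ext k; simp
      rw [this, stdMonomial_zero]; simp
    · have : (fun k : Fin n => (Pi.single j.succ 1 : Expo (n + 1)) k.succ) = Pi.single j 1 := by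
        ext k; simp [Pi.single_apply]
      rw [this, ih]; simp [Fin.succ_ne_zero, eq_comm]

theorem pow_mul_coeff {y : A} {s : R → R} (h : ∀ r : R, y * (r : A) = (s r : A) * y) (k : ℕ)
    (r : R) : y ^ k * (r : A) = (s^[k] r : A) * y ^ k := by
  induction k generalizing r with
  | zero => simp
  | succ k ih => rw [pow_succ, mul_assoc, h, ← mul_assoc, ih, mul_assoc, ← pow_succ]; rfl

theorem stdMonomial_mul_coeff (x : Fin n → A) (s : Fin n → R → R)
    (h : ∀ i (r : R), x i * (r : A) = (s i r : A) * x i) (α : Expo n) (r : R) :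
    stdMonomial x α * (r : A) =
      (((List.ofFn fun i => (s i)^[α i]).foldr (fun f g => f ∘ g) id) r : R) *
        stdMonomial x α := by
  induction n generalizing r with
  | zero => simp [stdMonomial]
  | succ n ih =>
    rw [stdMonomial_succ, mul_assoc, ih _ _ (fun i r => h i.succ r), ← mul_assoc,
      pow_mul_coeff (h 0), mul_assoc, List.ofFn_succ]
    rfl

/-- `a` and `b` agree up to a unit of the coefficient ring acting from the left. -/
def UnitAssoc (R : Subring A) (a b : A) : Prop := ∃ u : Rˣ, a = ((u : R) : A) * b

/-- `a` can be moved past units of the coefficient ring. -/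
def UnitNormal (R : Subring A) (a : A) : Prop :=
  ∀ u : Rˣ, ∃ v : Rˣ, a * ((u : R) : A) = ((v : R) : A) * a

namespace UnitAssoc

variable {a b c d : A}

theorem refl (a : A) : UnitAssoc R a a := ⟨1, by simp⟩

theorem symm (h : UnitAssoc R a b) : UnitAssoc R b a := by
  obtain ⟨u, rfl⟩ := h
  refine ⟨u⁻¹, ?_⟩
  rw [← mul_assoc, ← Subring.coe_mul, Units.inv_mul, Subring.coe_one, one_mul]

theorem trans (h : UnitAssoc R a b) (h' : UnitAssoc R b c) : UnitAssoc R a c := by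
  obtain ⟨u, rfl⟩ := h
  obtain ⟨v, rfl⟩ := h'
  exact ⟨u * v, by push_cast; rw [mul_assoc]⟩

theorem mul_right (h : UnitAssoc R a b) (c : A) : UnitAssoc R (a * c) (b * c) := by
  obtain ⟨u, rfl⟩ := h
  exact ⟨u, mul_assoc _ _ _⟩

theorem mul_left (h : UnitAssoc R a b) (hc : UnitNormal R c) : UnitAssoc R (c * a) (c * b) := by
  obtain ⟨u, rfl⟩ := h
  obtain ⟨v, hv⟩ := hc u
  exact ⟨v, by rw [← mul_assoc, hv, mul_assoc]⟩

end UnitAssoc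

namespace UnitNormal

variable {a b c : A}

theorem one : UnitNormal R (1 : A) := fun u => ⟨u, by simp⟩

theorem mul (ha : UnitNormal R a) (hb : UnitNormal R b) : UnitNormal R (a * b) := by
  intro u
  obtain ⟨v, hv⟩ := hb u
  obtain ⟨w, hw⟩ := ha v
  exact ⟨w, by rw [mul_assoc, hv, ← mul_assoc, hw, mul_assoc]⟩

theorem pow (ha : UnitNormal R a) (k : ℕ) : UnitNormal R (a ^ k) := by
  induction k with
  | zero => simpa using one
  | succ k ih => rw [pow_succ]; exact ih.mul ha

/-- In `a b c ~ a c b ~ c a b` the first unit appears between `a` and the rest; `ha` is what brings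
it to the front. -/
theorem comm_mul (ha : UnitNormal R a) (hac : UnitAssoc R (a * c) (c * a))
    (hbc : UnitAssoc R (b * c) (c * b)) : UnitAssoc R (a * b * c) (c * (a * b)) := by
  have h1 := hbc.mul_left ha
  have h2 := hac.mul_right b
  rw [← mul_assoc, ← mul_assoc] at h1
  exact h1.trans (by rwa [mul_assoc c] at h2)

theorem comm_pow (ha : UnitNormal R a) (hac : UnitAssoc R (a * c) (c * a)) (k : ℕ) :
    UnitAssoc R (a ^ k * c) (c * a ^ k) := by
  induction k with
  | zero => simpa using UnitAssoc.refl c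
  | succ k ih => rw [pow_succ']; exact ha.comm_mul hac ih

end UnitNormal

theorem stdMonomial_mul_comm (x : Fin n → A) (hx : ∀ i, UnitNormal R (x i)) (c : A)
    (h : ∀ i, UnitAssoc R (x i * c) (c * x i)) (α : Expo n) :
    UnitAssoc R (stdMonomial x α * c) (c * stdMonomial x α) := by
  induction n with
  | zero => simpa [stdMonomial] using UnitAssoc.refl c
  | succ n ih =>
    rw [stdMonomial_succ]
    exact ((hx 0).pow _).comm_mul ((hx 0).comm_pow (h 0) _)
      (ih _ (fun i => hx i.succ) (fun i => h i.succ) _)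

/-- The tail of `x^α` commutes with `x₀^β₀` up to a unit; afterwards the two powers of `x₀` merge
and the tails are handled by induction. All units created in the middle pass to the left because
powers of variables are `UnitNormal`. -/
theorem stdMonomial_mul_stdMonomial (x : Fin n → A) (hx : ∀ i, UnitNormal R (x i))
    (h : ∀ i j, UnitAssoc R (x i * x j) (x j * x i)) (α β : Expo n) :
    UnitAssoc R (stdMonomial x α * stdMonomial x β) (stdMonomial x (α + β)) := by
  induction n with
  | zero => simpa [stdMonomial] using UnitAssoc.refl (1 : A)
  | succ n ih =>
    rw [stdMonomial_succ, stdMonomial_succ x β, stdMonomial_succ x (α + β)]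
    have h0 : UnitAssoc R (stdMonomial (fun i => x i.succ) (fun i => α i.succ) * x 0 ^ β 0)
        (x 0 ^ β 0 * stdMonomial (fun i => x i.succ) (fun i => α i.succ)) :=
      stdMonomial_mul_comm _ (fun i => hx i.succ) _
        (fun i => ((hx 0).comm_pow (h 0 i.succ) _).symm) _
    have h1 := (h0.mul_right (stdMonomial (fun i => x i.succ) (fun i => β i.succ))).mul_left
      ((hx 0).pow (α 0))
    have h2 := (ih (fun i => x i.succ) (fun i => hx i.succ) (fun i j => h i.succ j.succ)
      (fun i => α i.succ) (fun i => β i.succ)).mul_left (((hx 0).pow (α 0)).mul ((hx 0).pow (β 0)))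
    rw [Pi.add_apply, pow_add]
    simp only [mul_assoc] at h1 h2 ⊢
    exact h1.trans h2

end Monomials

/-! ### Arithmetic of `σ^α` and `c_{α,β}` -/

namespace Extension

variable {A : Type*} [Ring A] {R : Subring A} {n m : ℕ} (E : Extension R n)

theorem basis_apply (α : Expo n) : E.basis α = E.mon α := Module.Basis.mk_apply _ _ _

theorem coeff_mon [DecidableEq (Expo n)] (α β : Expo n) :
    E.coeff (E.mon α) β = if α = β then 1 else 0 := by
  rw [coeff, ← basis_apply, Module.Basis.repr_self, Finsupp.single_apply]

@[simp] theorem coeff_mon_self (α : Expo n) : E.coeff (E.mon α) α = 1 := by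
  classical simp [coeff_mon]

@[simp] theorem coeff_add (f g : A) (α : Expo n) :
    E.coeff (f + g) α = E.coeff f α + E.coeff g α := by simp [coeff]

@[simp] theorem coeff_zero (α : Expo n) : E.coeff 0 α = 0 := by simp [coeff]

@[simp] theorem coeff_smul (r : R) (f : A) (α : Expo n) :
    E.coeff (r • f) α = r * E.coeff f α := by simp [coeff]

theorem coeff_coe_mul (r : R) (f : A) (α : Expo n) :
    E.coeff ((r : A) * f) α = r * E.coeff f α := E.coeff_smul r f α

/-- Identities in `R` such as the additivity and multiplicativity of `σ^α` are obtained from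
associativity and distributivity in `A` by cancelling `x^α` on the right. -/
theorem coe_mul_mon_injective {r s : R} (α : Expo n)
    (h : (r : A) * E.mon α = (s : A) * E.mon α) : r = s := by
  have := congrArg (fun f => E.coeff f α) h
  simpa [coeff_coe_mul] using this

theorem mon_single (i : Fin n) : E.mon (Pi.single i 1) = E.x i := stdMonomial_single _ _

theorem mon_zero : E.mon 0 = 1 := stdMonomial_zero _

variable {E} (hq : E.IsQuasiCommutative) (hb : E.IsBijective)
include hq

theorem x_mul_coe (i : Fin n) (r : R) : E.x i * (r : A) = (E.sigma i r : A) * E.x i := by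
  by_cases hr : r = 0
  · subst hr; simp [sigma]
  · obtain ⟨c, -, hc⟩ := hq.var_mul_coeff i r hr
    rw [sigma, hc, coeff_coe_mul, ← mon_single, coeff_mon_self, mul_one]

theorem mon_mul_coe (α : Expo n) (r : R) :
    E.mon α * (r : A) = (E.sigmaPow α r : A) * E.mon α :=
  stdMonomial_mul_coeff _ _ (x_mul_coe hq) _ _

theorem sigma_one (i : Fin n) : E.sigma i 1 = 1 := by
  apply E.coe_mul_mon_injective (Pi.single i 1)
  rw [mon_single, ← x_mul_coe hq]; simp

theorem sigma_mul (i : Fin n) (r s : R) : E.sigma i (r * s) = E.sigma i r * E.sigma i s := by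
  apply E.coe_mul_mon_injective (Pi.single i 1)
  rw [mon_single, ← x_mul_coe hq]
  push_cast
  rw [← mul_assoc, x_mul_coe hq, mul_assoc, x_mul_coe hq, mul_assoc]

theorem unitNormal_x (i : Fin n) : UnitNormal R (E.x i) := fun u =>
  ⟨⟨E.sigma i u, E.sigma i ↑u⁻¹, by rw [← sigma_mul hq, Units.mul_inv, sigma_one hq],
    by rw [← sigma_mul hq, Units.inv_mul, sigma_one hq]⟩, x_mul_coe hq i u⟩

theorem sigmaPow_add (α : Expo n) (r s : R) :
    E.sigmaPow α (r + s) = E.sigmaPow α r + E.sigmaPow α s := by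
  apply E.coe_mul_mon_injective α
  rw [← mon_mul_coe hq]
  push_cast
  rw [add_mul, mul_add, mon_mul_coe hq, mon_mul_coe hq]

theorem sigmaPow_mul (α : Expo n) (r s : R) :
    E.sigmaPow α (r * s) = E.sigmaPow α r * E.sigmaPow α s := by
  apply E.coe_mul_mon_injective α
  rw [← mon_mul_coe hq]
  push_cast
  rw [← mul_assoc, mon_mul_coe hq, mul_assoc, mon_mul_coe hq, mul_assoc]

include hb

theorem unitAssoc_x_mul_x (i j : Fin n) : UnitAssoc R (E.x i * E.x j) (E.x j * E.x i) := by
  have key : ∀ i j : Fin n, i < j → UnitAssoc R (E.x j * E.x i) (E.x i * E.x j) := by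
    intro i j hij
    obtain ⟨c, -, hc⟩ := hq.var_mul_var i j
    obtain ⟨u, rfl⟩ := hb.isUnit_of_lt i j hij c (by rw [hc, sub_self]; exact zero_mem _)
    exact ⟨u, hc⟩
  rcases lt_trichotomy i j with h | rfl | h
  · exact (key _ _ h).symm
  · exact UnitAssoc.refl _
  · exact key _ _ h

theorem exists_unit_mon_mul_mon (α β : Expo n) :
    ∃ u : Rˣ, (u : R) = E.cc α β ∧ E.mon α * E.mon β = ((u : R) : A) * E.mon (α + β) := by
  obtain ⟨u, hu⟩ := stdMonomial_mul_stdMonomial (R := R) E.x (unitNormal_x hq)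
    (unitAssoc_x_mul_x hq hb) α β
  have hu' : E.mon α * E.mon β = ((u : R) : A) * E.mon (α + β) := hu
  exact ⟨u, by rw [cc, hu', coeff_coe_mul, coeff_mon_self, mul_one], hu'⟩

theorem isUnit_cc (α β : Expo n) : IsUnit (E.cc α β) := by
  obtain ⟨u, hu, -⟩ := exists_unit_mon_mul_mon hq hb α β
  exact ⟨u, hu⟩

theorem mon_mul_mon (α β : Expo n) :
    E.mon α * E.mon β = (E.cc α β : A) * E.mon (α + β) := by
  obtain ⟨u, hu, h⟩ := exists_unit_mon_mul_mon hq hb α β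
  rw [h, hu]

omit hq in
theorem sigmaPow_bijective (α : Expo n) : Function.Bijective (E.sigmaPow α) := by
  have key : ∀ l : List (R → R), (∀ f ∈ l, Function.Bijective f) →
      Function.Bijective (l.foldr (fun f g => f ∘ g) id) := by
    intro l hl
    induction l with
    | nil => exact Function.bijective_id
    | cons f l ih =>
      exact (hl f (by simp)).comp (ih fun g hg => hl g (by simp [hg]))
  refine key _ fun f hf => ?_
  obtain ⟨i, rfl⟩ := (List.mem_ofFn' _ _).1 hf
  exact (hb.sigma_bijective i).iterate _

/-- `σ^α` as an automorphism of `R`. -/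
noncomputable def sigmaEquiv (α : Expo n) : R ≃+* R :=
  { Equiv.ofBijective _ (sigmaPow_bijective hb α) with
    map_add' := sigmaPow_add hq α
    map_mul' := sigmaPow_mul hq α }

theorem sigmaEquiv_apply (α : Expo n) (r : R) : sigmaEquiv hq hb α r = E.sigmaPow α r := rfl

/-- Both sides are the coefficient of `x^{α+β}` in `x^α x^β r`, with `r` moved to the left before or
after the two monomials are multiplied. -/
theorem sigmaPow_sigmaPow_mul_cc (α β : Expo n) (r : R) :
    E.sigmaPow α (E.sigmaPow β r) * E.cc α β = E.cc α β * E.sigmaPow (α + β) r := by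
  apply E.coe_mul_mon_injective (α + β)
  push_cast
  rw [mul_assoc, ← mon_mul_mon hq hb, ← mul_assoc, ← mon_mul_coe hq, mul_assoc,
    ← mon_mul_coe hq, ← mul_assoc, mon_mul_mon hq hb, mul_assoc, mul_assoc, ← mon_mul_coe hq]

/-- A term `r x^β` goes to `σ^α(r) c_{α,β} x^{α+β}`, and `β ↦ α + β` is injective, so different
terms never collide. -/
theorem coeff_mon_mul (α : Expo n) (a : A) :
    (∀ β, E.coeff (E.mon α * a) (α + β) = E.sigmaPow α (E.coeff a β) * E.cc α β) ∧
      ∀ δ, ¬ α ≤ δ → E.coeff (E.mon α * a) δ = 0 := by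
  classical
  have ha : a ∈ Submodule.span R (Set.range (stdMonomial E.x)) := E.span_eq_top trivial
  have h0 : E.sigmaPow α 0 = 0 := map_zero (sigmaEquiv hq hb α)
  have h1 : E.sigmaPow α 1 = 1 := map_one (sigmaEquiv hq hb α)
  induction ha using Submodule.span_induction with
  | mem x hx =>
    obtain ⟨κ, rfl⟩ := hx
    change (∀ β, E.coeff (E.mon α * E.mon κ) _ = E.sigmaPow α (E.coeff (E.mon κ) β) * _) ∧
      ∀ δ, _ → E.coeff (E.mon α * E.mon κ) δ = 0
    constructor
    · intro β
      rw [mon_mul_mon hq hb, coeff_coe_mul, coeff_mon, coeff_mon]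
      by_cases h : κ = β
      · simp [h, h1]
      · simp [h, h0]
    · intro δ hδ
      rw [mon_mul_mon hq hb, coeff_coe_mul, coeff_mon, if_neg, mul_zero]
      rintro rfl
      exact hδ le_self_add
  | zero => simp [h0]
  | add a b _ _ iha ihb =>
    constructor
    · intro β
      rw [mul_add, coeff_add, iha.1, ihb.1, coeff_add, sigmaPow_add hq, add_mul]
    · intro δ hδ
      rw [mul_add, coeff_add, iha.2 δ hδ, ihb.2 δ hδ, add_zero]
  | smul r a _ ih =>
    have e : E.mon α * (r • a) = E.sigmaPow α r • (E.mon α * a) := by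
      change E.mon α * ((r : A) * a) = (E.sigmaPow α r : A) * (E.mon α * a)
      rw [← mul_assoc, mon_mul_coe hq, mul_assoc]
    rw [e]
    constructor
    · intro β
      rw [coeff_smul, ih.1, coeff_smul, sigmaPow_mul hq, mul_assoc]
    · intro δ hδ
      rw [coeff_smul, ih.2 δ hδ, mul_zero]

end Extension

/-! ### Coefficients and supports of vectors -/

namespace Extension

variable {A : Type*} [Ring A] {R : Subring A} {n m : ℕ} (E : Extension R n)

/-- `vcoeff` at a fixed monomial, as an `R`-linear functional. -/
noncomputable def vcoeffLin (X : VMon n m) : (Fin m → A) →ₗ[R] R where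
  toFun f := E.vcoeff f X
  map_add' f g := by simp [vcoeff]
  map_smul' r f := by simp [vcoeff]

theorem vcoeffLin_apply (X : VMon n m) (f : Fin m → A) : E.vcoeffLin X f = E.vcoeff f X := rfl

theorem vcoeff_zero (X : VMon n m) : E.vcoeff 0 X = 0 := (E.vcoeffLin X).map_zero

theorem vcoeff_add (f g : Fin m → A) (X : VMon n m) :
    E.vcoeff (f + g) X = E.vcoeff f X + E.vcoeff g X := (E.vcoeffLin X).map_add f g

theorem vcoeff_sub (f g : Fin m → A) (X : VMon n m) :
    E.vcoeff (f - g) X = E.vcoeff f X - E.vcoeff g X := (E.vcoeffLin X).map_sub f g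

theorem coe_mul_smul (r : R) (a : A) (f : Fin m → A) : ((r : A) * a) • f = r • a • f :=
  mul_smul _ _ _

theorem exists_vcoeff_ne_zero {f : Fin m → A} (hf : f ≠ 0) : ∃ X, E.vcoeff f X ≠ 0 := by
  by_contra! h
  apply hf
  ext u
  apply E.basis.repr.injective
  ext α
  have := h (α, u)
  simp only [vcoeff, coeff] at this
  simp [this]

theorem finite_setOf_vcoeff_ne_zero (f : Fin m → A) : {X | E.vcoeff f X ≠ 0}.Finite := by
  have : {X : VMon n m | E.vcoeff f X ≠ 0} ⊆
      ⋃ u : Fin m, (fun α => (α, u)) '' ((E.basis.repr (f u)).support : Set (Expo n)) := by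
    rintro ⟨α, u⟩ h
    simp only [Set.mem_iUnion]
    exact ⟨u, α, by simpa [vcoeff, coeff] using h, rfl⟩
  exact (Set.finite_iUnion fun u => (Finset.finite_toSet _).image _).subset this

/-- The vectors all of whose monomials satisfy `P`. -/
def supported (P : VMon n m → Prop) : Submodule R (Fin m → A) where
  carrier := {f | ∀ Y, E.vcoeff f Y ≠ 0 → P Y}
  add_mem' {f g} hf hg Y hY := by
    by_contra h
    exact hY (by rw [vcoeff_add, not_not.1 (mt (hf Y) h), not_not.1 (mt (hg Y) h), add_zero])
  zero_mem' Y hY := absurd (E.vcoeff_zero Y) hY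
  smul_mem' r f hf Y hY := by
    refine hf Y fun h => hY ?_
    rw [← vcoeffLin_apply, map_smul, vcoeffLin_apply, h, smul_zero]

variable {E}

theorem supported_mono {P Q : VMon n m → Prop} (h : ∀ X, P X → Q X) :
    E.supported P ≤ E.supported Q := fun _ hf Y hY => h Y (hf Y hY)

section Mul

variable (hq : E.IsQuasiCommutative) (hb : E.IsBijective)
include hq hb

theorem vcoeff_mon_smul (α β : Expo n) (u : Fin m) (f : Fin m → A) :
    E.vcoeff (E.mon α • f) (α + β, u) = E.sigmaPow α (E.vcoeff f (β, u)) * E.cc α β :=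
  (coeff_mon_mul hq hb α (f u)).1 β

theorem exists_of_vcoeff_mon_smul_ne_zero {α : Expo n} {f : Fin m → A} {X : VMon n m}
    (h : E.vcoeff (E.mon α • f) X ≠ 0) : ∃ β, X.1 = α + β ∧ E.vcoeff f (β, X.2) ≠ 0 := by
  obtain ⟨δ, u⟩ := X
  have hle : α ≤ δ := by
    by_contra hα
    exact h ((coeff_mon_mul hq hb α (f u)).2 δ hα)
  obtain ⟨β, rfl⟩ := exists_add_of_le hle
  refine ⟨β, rfl, fun h0 => h ?_⟩
  rw [vcoeff_mon_smul hq hb]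
  rw [h0, ← sigmaEquiv_apply hq hb, map_zero, zero_mul]

/-- Since `c_{α,β}` is a unit and `σ^α` is injective, a cancellation seen after multiplication by
`x^α` already took place before it. -/
theorem vcoeff_mon_smul_eq_zero_iff {α β : Expo n} {u : Fin m} {f : Fin m → A} :
    E.vcoeff (E.mon α • f) (α + β, u) = 0 ↔ E.vcoeff f (β, u) = 0 := by
  rw [vcoeff_mon_smul hq hb, (isUnit_cc hq hb α β).mul_left_eq_zero, ← sigmaEquiv_apply hq hb,
    map_eq_zero_iff _ (sigmaEquiv hq hb α).injective]

omit hb in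
theorem mon_smul_smul (α : Expo n) (r : R) (f : Fin m → A) :
    E.mon α • r • f = E.sigmaPow α r • E.mon α • f := by
  change E.mon α • (r : A) • f = (E.sigmaPow α r : A) • E.mon α • f
  rw [smul_smul, smul_smul, mon_mul_coe hq]

theorem mon_smul_mon_smul (α β : Expo n) (f : Fin m → A) :
    E.mon α • E.mon β • f = E.cc α β • E.mon (α + β) • f := by
  change E.mon α • E.mon β • f = (E.cc α β : A) • E.mon (α + β) • f
  rw [smul_smul, smul_smul, mon_mul_mon hq hb]

variable [Nontrivial R] {le₀ : Expo n → Expo n → Prop} (hle₀ : E.IsMonomialOrder le₀)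
include hle₀

theorem isLM_mon_mul_mon (α β : Expo n) : E.IsLM le₀ (E.mon α * E.mon β) (α + β) := by
  classical
  refine ⟨(isUnit_cc hq hb α β).ne_zero, fun γ hγ => ?_⟩
  rw [mon_mul_mon hq hb, coeff_coe_mul, coeff_mon] at hγ
  have : α + β = γ := by
    by_contra h
    simp [h] at hγ
  exact this ▸ hle₀.refl _

variable {le : VMon n m → VMon n m → Prop} (hle : E.IsVMonomialOrder le₀ le)
include hle

theorem le_add_left {α β : Expo n} {u v : Fin m} (γ : Expo n) (h : le (α, u) (β, v)) :
    le (γ + α, u) (γ + β, v) :=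
  hle.mul α β γ u v h _ _ (isLM_mon_mul_mon hq hb hle₀ γ α) (isLM_mon_mul_mon hq hb hle₀ γ β)

end Mul

/-- The strict order attached to `le`. -/
def SLT (le : VMon n m → VMon n m → Prop) (X Y : VMon n m) : Prop := le X Y ∧ X ≠ Y

/-! ### Well-foundedness of the monomial order and leading monomials -/

section Order

variable {le₀ : Expo n → Expo n → Prop}
  {le : VMon n m → VMon n m → Prop} (hle : E.IsVMonomialOrder le₀ le)
include hle

theorem slt_of_le_of_slt {X Y Z : VMon n m} (h : le X Y) (h' : SLT le Y Z) : SLT le X Z :=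
  ⟨hle.trans _ _ _ h h'.1, by rintro rfl; exact h'.2 (hle.antisymm _ _ h'.1 h)⟩

/-- Compatibility with the total degree bounds every exponent of a smaller monomial by `X.1.deg`.
The cardinality of this set then serves as a rank function for the order. -/
theorem finite_setOf_le (X : VMon n m) : {Y | le Y X}.Finite := by
  have : {Y : VMon n m | le Y X} ⊆ (Set.Iic fun _ => X.1.deg) ×ˢ Set.univ := by
    rintro ⟨β, v⟩ hY
    simp only [Set.mem_prod, Set.mem_Iic, Set.mem_univ, and_true]
    have hdeg : β.deg ≤ X.1.deg := by
      by_contra! h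
      have := hle.antisymm _ _ hY (hle.deg X.1 β X.2 v h)
      rw [← this] at h
      exact lt_irrefl _ h
    exact fun i => (Finset.single_le_sum (f := β) (fun _ _ => Nat.zero_le _)
      (Finset.mem_univ i)).trans hdeg
  exact ((Set.finite_Iic _).prod Set.finite_univ).subset this

theorem ncard_setOf_le_lt {X Y : VMon n m} (h : SLT le X Y) :
    {Z | le Z X}.ncard < {Z | le Z Y}.ncard :=
  Set.ncard_lt_ncard ⟨fun _ hZ => hle.trans _ _ _ hZ h.1,
    fun hs => h.2 (hle.antisymm _ _ h.1 (hs (hle.refl Y)))⟩ (finite_setOf_le hle Y)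

theorem wellFounded_slt : WellFounded (SLT le) :=
  Subrelation.wf (ncard_setOf_le_lt hle) (measure fun X => {Z | le Z X}.ncard).wf

theorem exists_isVLM {f : Fin m → A} (hf : f ≠ 0) : ∃ X, E.IsVLM le f X := by
  have hfin := E.finite_setOf_vcoeff_ne_zero f
  have hne : hfin.toFinset.Nonempty := by
    obtain ⟨X, hX⟩ := E.exists_vcoeff_ne_zero hf
    exact ⟨X, by simpa using hX⟩
  obtain ⟨X, hX, hmax⟩ := hfin.toFinset.exists_max_image (fun X => {Z | le Z X}.ncard) hne
  refine ⟨X, by simpa using hX, fun Y hY => ?_⟩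
  by_contra h
  have hXY : SLT le X Y :=
    ⟨(hle.total X Y).resolve_right h, by rintro rfl; exact h (hle.refl _)⟩
  exact absurd (hmax Y (by simpa using hY)) (not_le.2 (ncard_setOf_le_lt hle hXY))

theorem IsVLM.unique {f : Fin m → A} {X Y : VMon n m} (hX : E.IsVLM le f X)
    (hY : E.IsVLM le f Y) : X = Y :=
  hle.antisymm _ _ (hY.2 _ hX.1) (hX.2 _ hY.1)

omit hle in
theorem isVLM_iff {f : Fin m → A} {X : VMon n m} :
    E.IsVLM le f X ↔ f ∈ E.supported (le · X) ∧ E.vcoeff f X ≠ 0 := and_comm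

omit hle in
theorem mem_supported_slt {f : Fin m → A} {X : VMon n m}
    (hf : f ∈ E.supported (le · X)) (h : E.vcoeff f X = 0) : f ∈ E.supported (SLT le · X) :=
  fun Y hY => ⟨hf Y hY, by rintro rfl; exact hY h⟩

end Order

theorem IsVLM.ne_zero {le : VMon n m → VMon n m → Prop} {f : Fin m → A} {X : VMon n m}
    (hX : E.IsVLM le f X) : f ≠ 0 := by
  rintro rfl
  exact hX.1 (E.vcoeff_zero X)

variable (E) in
/-- The `R`-submodule spanned by the multiples `x^α g`, `g ∈ G`, whose leading monomial
satisfies `P`. -/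
def filt (le : VMon n m → VMon n m → Prop) (G : Finset (Fin m → A)) (P : VMon n m → Prop) :
    Submodule R (Fin m → A) :=
  Submodule.span R {v | ∃ g ∈ G, ∃ (α β : Expo n) (u : Fin m),
    E.IsVLM le g (β, u) ∧ P (α + β, u) ∧ v = E.mon α • g}

/-! ### Combinations of multiples of `G` with bounded leading monomials -/

section Filt

variable {le : VMon n m → VMon n m → Prop} {G : Finset (Fin m → A)}

theorem filt_mono {G' : Finset (Fin m → A)} {P Q : VMon n m → Prop} (hG : G ⊆ G')
    (h : ∀ X, P X → Q X) : E.filt le G P ≤ E.filt le G' Q := by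
  refine Submodule.span_mono ?_
  rintro v ⟨g, hg, α, β, u, hl, hP, rfl⟩
  exact ⟨g, hG hg, α, β, u, hl, h _ hP, rfl⟩

theorem mon_smul_mem_filt {P : VMon n m → Prop} {g : Fin m → A} (hg : g ∈ G) {α β : Expo n}
    {u : Fin m} (hl : E.IsVLM le g (β, u)) (hP : P (α + β, u)) :
    E.mon α • g ∈ E.filt le G P :=
  Submodule.subset_span ⟨g, hg, α, β, u, hl, hP, rfl⟩

theorem mem_filt_of_mem {P : VMon n m → Prop} {g : Fin m → A} (hg : g ∈ G) {X : VMon n m}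
    (hl : E.IsVLM le g X) (hP : P X) : g ∈ E.filt le G P := by
  have := mon_smul_mem_filt (E := E) (P := P) hg (α := 0) (β := X.1) (u := X.2) hl
    (by simpa using hP)
  rwa [mon_zero, one_smul] at this

theorem filt_le_span (P : VMon n m → Prop) {f : Fin m → A} (hf : f ∈ E.filt le G P) :
    f ∈ Submodule.span A (G : Set (Fin m → A)) := by
  induction hf using Submodule.span_induction with
  | mem v hv =>
    obtain ⟨g, hg, α, β, u, -, -, rfl⟩ := hv
    exact Submodule.smul_mem _ _ (Submodule.subset_span hg)
  | zero => exact zero_mem _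
  | add a b _ _ ha hb => exact add_mem ha hb
  | smul r a _ ha => exact Submodule.smul_mem _ (r : A) ha

variable (hq : E.IsQuasiCommutative) (hb : E.IsBijective)
include hq hb

theorem mon_smul_filt {P Q : VMon n m → Prop} (θ : Expo n)
    (h : ∀ α u, P (α, u) → Q (θ + α, u)) {f : Fin m → A} (hf : f ∈ E.filt le G P) :
    E.mon θ • f ∈ E.filt le G Q := by
  induction hf using Submodule.span_induction with
  | mem v hv =>
    obtain ⟨g, hg, α, β, u, hl, hP, rfl⟩ := hv
    rw [mon_smul_mon_smul hq hb]
    refine Submodule.smul_mem _ _ (mon_smul_mem_filt hg hl ?_)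
    rw [add_assoc]
    exact h _ _ hP
  | zero => rw [smul_zero]; exact zero_mem _
  | add a b _ _ ha hb => rw [smul_add]; exact add_mem ha hb
  | smul r a _ ha => rw [mon_smul_smul hq]; exact Submodule.smul_mem _ _ ha

theorem mul_smul_mem_filt_true (a : A) {f : Fin m → A}
    (hf : f ∈ E.filt le G fun _ => True) : a • f ∈ E.filt le G fun _ => True := by
  have ha : a ∈ Submodule.span R (Set.range (stdMonomial E.x)) := E.span_eq_top trivial
  induction ha using Submodule.span_induction with
  | mem x hx =>
    obtain ⟨κ, rfl⟩ := hx
    exact mon_smul_filt hq hb κ (fun _ _ _ => trivial) hf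
  | zero => rw [zero_smul]; exact zero_mem _
  | add a b _ _ ha hb => rw [add_smul]; exact add_mem ha hb
  | smul r a _ ha =>
    rw [smul_assoc]
    exact Submodule.smul_mem _ _ ha

variable {le₀ : Expo n → Expo n → Prop} (hle : E.IsVMonomialOrder le₀ le)
include hle

theorem span_le_filt {f : Fin m → A} (h0 : ∀ g ∈ G, g ≠ 0)
    (hf : f ∈ Submodule.span A (G : Set (Fin m → A))) : f ∈ E.filt le G fun _ => True := by
  induction hf using Submodule.span_induction with
  | mem g hg =>
    obtain ⟨X, hX⟩ := exists_isVLM hle (h0 g hg)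
    exact mem_filt_of_mem hg hX trivial
  | zero => exact zero_mem _
  | add a b _ _ ha hb => exact add_mem ha hb
  | smul a f _ hf => exact mul_smul_mem_filt_true hq hb a hf

-- Only finitely many multiples occur in a combination, so the largest of their leading monomials
-- serves as `Y`. The zero vector is separate, since `P` may hold nowhere.
omit hq hb in
theorem exists_mem_filt_le {P : VMon n m → Prop} {f : Fin m → A} (hf : f ∈ E.filt le G P) :
    f = 0 ∨ ∃ Y, P Y ∧ f ∈ E.filt le G (le · Y) := by
  induction hf using Submodule.span_induction with
  | mem v hv =>
    obtain ⟨g, hg, α, β, u, hl, hP, rfl⟩ := hv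
    exact Or.inr ⟨_, hP, mon_smul_mem_filt hg hl (hle.refl _)⟩
  | zero => exact Or.inl rfl
  | add a b _ _ ha hb =>
    rcases ha with rfl | ⟨Y, hY, ha⟩
    · simpa using hb
    rcases hb with rfl | ⟨Z, hZ, hb⟩
    · exact Or.inr ⟨Y, hY, by simpa using ha⟩
    rcases hle.total Y Z with h | h
    · exact Or.inr ⟨Z, hZ, add_mem
        (filt_mono subset_rfl (fun X hX => hle.trans _ _ _ hX h) ha) hb⟩
    · exact Or.inr ⟨Y, hY, add_mem ha
        (filt_mono subset_rfl (fun X hX => hle.trans _ _ _ hX h) hb)⟩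
  | smul r a _ ha =>
    rcases ha with rfl | ⟨Y, hY, ha⟩
    · exact Or.inl (smul_zero _)
    · exact Or.inr ⟨Y, hY, Submodule.smul_mem _ _ ha⟩

variable [Nontrivial R] (hle₀ : E.IsMonomialOrder le₀)
include hle₀

theorem slt_add_left {α β : Expo n} {u v : Fin m} (γ : Expo n) (h : SLT le (α, u) (β, v)) :
    SLT le (γ + α, u) (γ + β, v) := by
  refine ⟨le_add_left hq hb hle₀ hle γ h.1, fun e => h.2 ?_⟩
  simpa using e

/-- Each monomial of `x^α g` is `x^α` times a monomial of `g`, hence lies below `x^α lm(g)`; the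
hypothesis `h` absorbs this passage to smaller monomials. -/
theorem filt_le_supported {P Q : VMon n m → Prop} (h : ∀ X Y, le X Y → P Y → Q X) :
    E.filt le G P ≤ E.supported Q := by
  refine Submodule.span_le.2 ?_
  rintro v ⟨g, hg, α, β, u, hl, hP, rfl⟩ ⟨δ, v⟩ hY
  obtain ⟨κ, rfl, hκ⟩ := exists_of_vcoeff_mon_smul_ne_zero hq hb hY
  exact h _ _ (le_add_left hq hb hle₀ hle α (hl.2 _ hκ)) hP

end Filt

end Extension

/-! ### Reduction steps as subtraction of homogeneous combinations -/

namespace Extension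

variable {A : Type*} [Ring A] {R : Subring A} {n m : ℕ} {E : Extension R n}
  {le : VMon n m → VMon n m → Prop} {G : Finset (Fin m → A)}

/-- The coefficient of `∑ r_i x^{α_i} f_i` at `x^δ e_u` is exactly the sum prescribed in the
definition of a reduction, so the explicit data amount to one element of `filt` at the monomial `X`.
-/
theorem reducesStep_iff (hq : E.IsQuasiCommutative) (hb : E.IsBijective)
    {f h : Fin m → A} (hf : f ≠ 0) :
    E.ReducesStep le G f h ↔ ∃ X, E.IsVLM le f X ∧ ∃ p ∈ E.filt le G (· = X),
      E.vcoeff f X = E.vcoeff p X ∧ h = f - p := by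
  have key : ∀ {t : ℕ} (δ : Expo n) (u : Fin m) (g : Fin t → Fin m → A) (r : Fin t → R)
      (α β : Fin t → Expo n), (∀ i, α i + β i = δ) →
      E.vcoeff (∑ i, ((r i : A) * E.mon (α i)) • g i) (δ, u) =
        ∑ i, r i * E.sigmaPow (α i) (E.vcoeff (g i) (β i, u)) * E.cc (α i) (β i) := by
    intro t δ u g r α β hαβ
    rw [← vcoeffLin_apply, map_sum]
    refine Finset.sum_congr rfl fun i _ => ?_
    rw [coe_mul_smul, map_smul, vcoeffLin_apply, ← hαβ i, vcoeff_mon_smul hq hb, smul_eq_mul,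
      mul_assoc]
  constructor
  · rintro (⟨h0, -⟩ | ⟨δ, u, hl, t, g, r, α, β, hg, hgl, hαβ, hv, rfl⟩)
    · exact absurd h0 hf
    refine ⟨(δ, u), hl, _, Submodule.sum_mem _ fun i _ => ?_,
      by rw [key δ u g r α β hαβ]; exact hv, rfl⟩
    rw [coe_mul_smul]
    exact Submodule.smul_mem _ _ (mon_smul_mem_filt (hg i) (hgl i) (by rw [hαβ i]))
  · rintro ⟨⟨δ, u⟩, hl, p, hp, hv, rfl⟩
    obtain ⟨t, r, w, rfl⟩ := Submodule.mem_span_set'.1 hp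
    choose g hg α β v hgl hX hw using fun i => (w i).2
    have hv' : ∀ i, v i = u := fun i => congrArg Prod.snd (hX i)
    have hαβ : ∀ i, α i + β i = δ := fun i => congrArg Prod.fst (hX i)
    have hp' : ∑ i, r i • (w i : Fin m → A) = ∑ i, ((r i : A) * E.mon (α i)) • g i :=
      Finset.sum_congr rfl fun i _ => by rw [hw i, coe_mul_smul]
    refine Or.inr ⟨δ, u, hl, t, g, r, α, β, hg, fun i => hv' i ▸ hgl i, hαβ, ?_, by rw [hp']⟩
    rw [hv, hp', key δ u g r α β hαβ]

theorem not_isReduced_of_mem_filt {f p : Fin m → A} {X : VMon n m}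
    (hq : E.IsQuasiCommutative) (hb : E.IsBijective) (hf : E.IsVLM le f X)
    (hp : p ∈ E.filt le G (· = X)) (hv : E.vcoeff f X = E.vcoeff p X) :
    ¬ E.IsReduced le G f := by
  rintro (h | h)
  · exact hf.ne_zero h
  · exact h ⟨f - p, (reducesStep_iff hq hb hf.ne_zero).2 ⟨X, hf, p, hp, hv, rfl⟩⟩

/-! ### S-vectors and Buchberger's criterion -/

section SVector

variable (E) in
/-- The S-vector as a linear function of the syzygy. -/
noncomputable def sVectorLin (S : Finset (Fin m → A)) (γ : S → Expo n) :
    (S → R) →ₗ[R] (Fin m → A) :=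
  Fintype.linearCombination R fun g : S => E.mon (γ g) • (g : Fin m → A)

theorem sVectorLin_apply (S : Finset (Fin m → A)) (γ : S → Expo n) (b : S → R) :
    E.sVectorLin S γ b = E.sVector S γ b := by
  rw [sVectorLin, Fintype.linearCombination_apply, sVector]
  exact Finset.sum_congr rfl fun g _ => (coe_mul_smul _ _ _).symm

theorem LcmData.unique {le₀ : Expo n → Expo n → Prop} (hle : E.IsVMonomialOrder le₀ le)
    {S : Finset (Fin m → A)} (hS : S.Nonempty) {u u' : Fin m} {β γ β' γ' : S → Expo n}
    (h : E.LcmData le S u β γ) (h' : E.LcmData le S u' β' γ') : u = u' ∧ β = β' ∧ γ = γ' := by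
  have key : ∀ g : S, (β g, u) = (β' g, u') := fun g => (h.lead g).unique hle (h'.lead g)
  obtain ⟨g, hg⟩ := hS
  have hβ : β = β' := funext fun g => congrArg Prod.fst (key g)
  subst hβ
  exact ⟨congrArg Prod.snd (key ⟨g, hg⟩), rfl,
    funext fun g => add_right_cancel ((h.add g).trans (h'.add g).symm)⟩

variable (E) in
/-- All S-vectors attached to `S` are `R`-combinations of multiples of elements of `G` with
leading monomials below `X_S`. -/
def Treated (le : VMon n m → VMon n m → Prop) (G S : Finset (Fin m → A)) : Prop :=
  ∀ u β γ, E.LcmData le S u β γ → ∀ b ∈ E.syz S u β γ,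
    E.sVector S γ b ∈ E.filt le G (SLT le · (Finset.univ.sup β, u))

theorem Treated.mono {G' S : Finset (Fin m → A)} (h : E.Treated le G S) (hG : G ⊆ G') :
    E.Treated le G' S :=
  fun u β γ hd b hb => filt_mono hG (fun _ h => h) (h u β γ hd b hb)

theorem treated_of_not_lcmNeZero {S : Finset (Fin m → A)} (h : ¬ E.LcmNeZero le S) :
    E.Treated le G S :=
  fun u β γ hd => absurd ⟨u, β, γ, hd⟩ h

theorem treated_of_lcmData {le₀ : Expo n → Expo n → Prop} (hle : E.IsVMonomialOrder le₀ le)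
    {S : Finset (Fin m → A)} {u : Fin m} {β γ : S → Expo n} (hd : E.LcmData le S u β γ)
    (h : ∀ b ∈ E.syz S u β γ,
      E.sVector S γ b ∈ E.filt le G (SLT le · (Finset.univ.sup β, u))) :
    E.Treated le G S := by
  intro u' β' γ' hd' b hb
  -- For empty `S` the index `u` is not determined by the data, but the S-vector is `0`.
  rcases S.eq_empty_or_nonempty with rfl | hS
  · simp [sVector]
  · obtain ⟨rfl, rfl, rfl⟩ := hd.unique hle hS hd'
    exact h b hb

variable (hq : E.IsQuasiCommutative) (hb : E.IsBijective)
include hq hb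

theorem vcoeff_sVector {S : Finset (Fin m → A)} {u : Fin m} {β γ : S → Expo n}
    (hd : E.LcmData le S u β γ) (b : S → R) :
    E.vcoeff (E.sVector S γ b) (Finset.univ.sup β, u) =
      ∑ g : S, b g * (E.sigmaPow (γ g) (E.vcoeff (g : Fin m → A) (β g, u)) * E.cc (γ g) (β g)) := by
  rw [sVector, ← vcoeffLin_apply, map_sum]
  refine Finset.sum_congr rfl fun g _ => ?_
  rw [coe_mul_smul, map_smul, vcoeffLin_apply, ← hd.add g, vcoeff_mon_smul hq hb, smul_eq_mul]

/-- The defining equation of a syzygy says that the terms at `X_S` cancel. -/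
theorem mem_syz_iff {S : Finset (Fin m → A)} {u : Fin m} {β γ : S → Expo n}
    (hd : E.LcmData le S u β γ) (b : S → R) :
    b ∈ E.syz S u β γ ↔ E.vcoeff (E.sVector S γ b) (Finset.univ.sup β, u) = 0 := by
  rw [vcoeff_sVector hq hb hd, syz, LinearMap.mem_ker, Fintype.linearCombination_apply]
  rfl

omit hq hb in
theorem sVector_mem_filt {S : Finset (Fin m → A)} (hS : S ⊆ G) {u : Fin m} {β γ : S → Expo n}
    (hd : E.LcmData le S u β γ) (b : S → R) :
    E.sVector S γ b ∈ E.filt le G (· = (Finset.univ.sup β, u)) := by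
  refine Submodule.sum_mem _ fun g _ => ?_
  rw [coe_mul_smul]
  exact Submodule.smul_mem _ _ (mon_smul_mem_filt (hS g.2) (hd.lead g) (by rw [hd.add g]))

variable {le₀ : Expo n → Expo n → Prop} (hle : E.IsVMonomialOrder le₀ le)
include hle

/-- Every homogeneous combination comes from an S-vector. -/
theorem exists_sVector_of_mem_filt {X : VMon n m} {p : Fin m → A}
    (hp : p ∈ E.filt le G (· = X)) :
    ∃ S ⊆ G, ∃ (β γ : S → Expo n) (θ : Expo n) (b : S → R), E.LcmData le S X.2 β γ ∧
      θ + Finset.univ.sup β = X.1 ∧ p = E.mon θ • E.sVector S γ b := by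
  classical
  obtain ⟨δ, u⟩ := X
  -- All elements whose leading monomial divides `X` are taken at once; those not occurring in `p`
  -- receive coefficient `0`.
  let S := G.filter fun g => ∃ β, E.IsVLM le g (β, u) ∧ β ≤ δ
  choose β hβ hβδ using fun g : S => (Finset.mem_filter.1 g.2).2
  have hsup : Finset.univ.sup β ≤ δ := Finset.sup_le fun g _ => hβδ g
  let γ : S → Expo n := fun g => Finset.univ.sup β - β g
  have hγ : ∀ g, γ g + β g = Finset.univ.sup β := fun g =>
    tsub_add_cancel_of_le (Finset.le_sup (f := β) (Finset.mem_univ g))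
  let θ : Expo n := δ - Finset.univ.sup β
  have hθ : θ + Finset.univ.sup β = δ := tsub_add_cancel_of_le hsup
  have hspan : p ∈ Submodule.span R
      (Set.range fun g : S => E.mon (θ + γ g) • (g : Fin m → A)) := by
    refine Submodule.span_mono ?_ hp
    rintro v ⟨g, hg, α, β', u', hl, hX, rfl⟩
    obtain ⟨rfl, rfl⟩ := Prod.mk.inj hX
    have hgS : g ∈ S := Finset.mem_filter.2 ⟨hg, β', hl, le_add_self⟩
    have hβ' : β ⟨g, hgS⟩ = β' :=
      congrArg Prod.fst ((hβ ⟨g, hgS⟩).unique hle hl)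
    refine ⟨⟨g, hgS⟩, ?_⟩
    have : θ + γ ⟨g, hgS⟩ = α := by
      apply add_right_cancel (b := β ⟨g, hgS⟩)
      rw [add_assoc, hγ, hθ, hβ']
    simp only [this]
  obtain ⟨r, rfl⟩ := (Submodule.mem_span_range_iff_exists_fun R).1 hspan
  choose c hc using fun g : S => isUnit_cc hq hb θ (γ g)
  -- The witness `b_g` solves `σ^θ(b_g) c_{θ,γ_g} = r_g`.
  refine ⟨S, Finset.filter_subset _ _, β, γ, θ,
    fun g => (sigmaEquiv hq hb θ).symm (r g * ↑(c g)⁻¹), ⟨hβ, hγ⟩, hθ, ?_⟩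
  rw [sVector, Finset.smul_sum]
  refine Finset.sum_congr rfl fun g _ => ?_
  rw [coe_mul_smul, mon_smul_smul hq, mon_smul_mon_smul hq hb, ← sigmaEquiv_apply hq hb,
    RingEquiv.apply_symm_apply, ← hc g, smul_smul, mul_assoc, Units.inv_mul, mul_one]

omit hq hb hle in
theorem exists_add_of_mem_filt_le {X : VMon n m} {f : Fin m → A}
    (hf : f ∈ E.filt le G (le · X)) :
    ∃ p ∈ E.filt le G (· = X), ∃ q ∈ E.filt le G (SLT le · X), f = p + q := by
  have : f ∈ E.filt le G (· = X) ⊔ E.filt le G (SLT le · X) := by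
    rw [filt, filt, ← Submodule.span_union]
    refine Submodule.span_mono ?_ hf
    rintro v ⟨g, hg, α, β, u, hl, hX, rfl⟩
    by_cases h : (α + β, u) = X
    · exact Or.inl ⟨g, hg, α, β, u, hl, h, rfl⟩
    · exact Or.inr ⟨g, hg, α, β, u, hl, ⟨hX, h⟩, rfl⟩
  obtain ⟨p, hp, q, hq, h⟩ := Submodule.mem_sup.1 this
  exact ⟨p, hp, q, hq, h.symm⟩

variable (hle₀ : E.IsMonomialOrder le₀) [Nontrivial R]
include hle₀

theorem vcoeff_eq_zero_of_mem_filt_slt {X : VMon n m} {q : Fin m → A}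
    (h : q ∈ E.filt le G (SLT le · X)) : E.vcoeff q X = 0 := by
  by_contra h0
  exact (filt_le_supported (Q := (SLT le · X)) hq hb hle hle₀
    (fun _ _ => slt_of_le_of_slt hle) h X h0).2 rfl

theorem mon_smul_mem_filt_slt {f : Fin m → A} {δ θ : Expo n} {u : Fin m}
    (hf : f ∈ E.filt le G (SLT le · (δ, u))) :
    E.mon θ • f ∈ E.filt le G (SLT le · (θ + δ, u)) := by
  have key : ∀ (α : Expo n) (v : Fin m), SLT le (α, v) (δ, u) → SLT le (θ + α, v) (θ + δ, u) :=
    fun α v h => slt_add_left hq hb hle hle₀ θ h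
  exact mon_smul_filt (P := (SLT le · (δ, u))) (Q := (SLT le · (θ + δ, u))) hq hb θ key hf

theorem mon_smul_sVector_mem_filt {S : Finset (Fin m → A)} (hT : E.Treated le G S) {u : Fin m}
    {β γ : S → Expo n} (hd : E.LcmData le S u β γ) {θ : Expo n} {b : S → R}
    (h0 : E.vcoeff (E.mon θ • E.sVector S γ b) (θ + Finset.univ.sup β, u) = 0) :
    E.mon θ • E.sVector S γ b ∈ E.filt le G (SLT le · (θ + Finset.univ.sup β, u)) :=
  mon_smul_mem_filt_slt hq hb hle hle₀
    (hT u β γ hd b ((mem_syz_iff hq hb hd b).2 ((vcoeff_mon_smul_eq_zero_iff hq hb).1 h0)))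

/-- The part `p` at `X` must cancel by itself, since the lower part does not reach `X`. It is `x^θ`
times an S-vector, whose `b` is then a syzygy, so being treated allows it to be rewritten below `X`.
-/
theorem mem_filt_slt_of_vcoeff_eq_zero (hT : ∀ S ⊆ G, E.Treated le G S) {X : VMon n m}
    {f : Fin m → A} (hf : f ∈ E.filt le G (le · X)) (h0 : E.vcoeff f X = 0) :
    f ∈ E.filt le G (SLT le · X) := by
  obtain ⟨p, hp, q, hqf, rfl⟩ := exists_add_of_mem_filt_le hf
  refine add_mem ?_ hqf
  rw [vcoeff_add, vcoeff_eq_zero_of_mem_filt_slt hq hb hle hle₀ hqf, add_zero] at h0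
  obtain ⟨S, hS, β, γ, θ, b, hd, hθ, rfl⟩ := exists_sVector_of_mem_filt hq hb hle hp
  have hX : X = (θ + Finset.univ.sup β, X.2) := Prod.ext hθ.symm rfl
  rw [hX] at h0 ⊢
  exact mon_smul_sVector_mem_filt hq hb hle hle₀ (hT S hS) hd h0

/-- As long as the bound `X` exceeds `lm(f)`, the coefficient at `X` vanishes and the bound can be
lowered; well-foundedness stops this at `lm(f)`. -/
theorem exists_isVLM_mem_filt (hT : ∀ S ⊆ G, E.Treated le G S) {f : Fin m → A} (hf : f ≠ 0)
    (X : VMon n m) (hX : f ∈ E.filt le G (le · X)) :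
    ∃ Y, E.IsVLM le f Y ∧ f ∈ E.filt le G (le · Y) := by
  induction X using (wellFounded_slt hle).induction with
  | _ X ih =>
    by_cases h0 : E.vcoeff f X = 0
    · obtain ⟨Y, hY, hfY⟩ := (exists_mem_filt_le hle
        (mem_filt_slt_of_vcoeff_eq_zero hq hb hle hle₀ hT hX h0)).resolve_left hf
      exact ih Y hY hfY
    · exact ⟨X, isVLM_iff.2 ⟨filt_le_supported hq hb hle hle₀
        (fun _ _ h h' => hle.trans _ _ _ h h') hX, h0⟩, hX⟩

/-- **Buchberger's criterion**. -/
theorem not_isReduced_of_treated (hT : ∀ S ⊆ G, E.Treated le G S) (hG : ∀ g ∈ G, g ≠ 0)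
    {f : Fin m → A} (hf : f ∈ Submodule.span A (G : Set (Fin m → A))) (h0 : f ≠ 0) :
    ¬ E.IsReduced le G f := by
  obtain ⟨X, -, hX⟩ := (exists_mem_filt_le hle
    (span_le_filt hq hb hle hG hf)).resolve_left h0
  obtain ⟨Y, hY, hfY⟩ := exists_isVLM_mem_filt hq hb hle hle₀ hT h0 X hX
  obtain ⟨p, hp, q, hqf, rfl⟩ := exists_add_of_mem_filt_le hfY
  exact not_isReduced_of_mem_filt hq hb hY hp
    (by rw [vcoeff_add, vcoeff_eq_zero_of_mem_filt_slt hq hb hle hle₀ hqf, add_zero])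

end SVector

/-! ### Termination: Dickson's lemma, ascending left ideals and a lexicographic rank -/

section Termination

variable (hq : E.IsQuasiCommutative) (hb : E.IsBijective)

/-- The leading coefficient at `x^β e_u` when coefficients are written on the right. -/
noncomputable def rightCoeff (f : Fin m → A) (X : VMon n m) : R :=
  (sigmaEquiv hq hb X.1).symm (E.vcoeff f X)

/-- If `lc(g) = σ^β(l)`, then `x^α g` has leading coefficient `c_{α,β} σ^{α+β}(l)`, a unit times
`σ^δ(l)`. After normalisation the coefficients of different `g` can therefore be compared in one
left ideal that does not depend on `δ`. -/
theorem not_isReduced_of_rightCoeff_mem_span {f : Fin m → A} {δ : Expo n} {u : Fin m}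
    (hf : E.IsVLM le f (δ, u)) (L : Set R)
    (hL : ∀ l ∈ L, ∃ g ∈ G, ∃ β ≤ δ, E.IsVLM le g (β, u) ∧ l = rightCoeff hq hb g (β, u))
    (h : rightCoeff hq hb f (δ, u) ∈ Ideal.span L) : ¬ E.IsReduced le G f := by
  -- `J` is the left ideal of the coefficients at `x^δ e_u` that a reduction by `G` can cancel.
  let J : Ideal R := (E.filt le G (· = (δ, u))).map (E.vcoeffLin (δ, u))
  have hJ : Ideal.span L ≤ J.comap (sigmaEquiv hq hb δ) := by
    refine Ideal.span_le.2 fun l hl => ?_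
    obtain ⟨g, hg, β, hβ, hgl, rfl⟩ := hL l hl
    obtain ⟨α, rfl⟩ : ∃ α, δ = α + β := ⟨δ - β, (tsub_add_cancel_of_le hβ).symm⟩
    obtain ⟨c, hc⟩ := isUnit_cc hq hb α β
    have h1 : E.vcoeff (E.mon α • g) (α + β, u) ∈ J :=
      ⟨_, mon_smul_mem_filt hg hgl rfl, rfl⟩
    have h2 := sigmaPow_sigmaPow_mul_cc hq hb α β (rightCoeff hq hb g (β, u))
    have h3 : E.sigmaPow β (rightCoeff hq hb g (β, u)) = E.vcoeff g (β, u) :=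
      (sigmaEquiv hq hb β).apply_symm_apply _
    rw [vcoeff_mon_smul hq hb, ← h3, h2, ← hc] at h1
    have h4 := J.mul_mem_left (↑c⁻¹ : R) h1
    rwa [← mul_assoc, Units.inv_mul, one_mul] at h4
  obtain ⟨p, hp, hpv⟩ := hJ h
  refine not_isReduced_of_mem_filt hq hb hf hp ?_
  exact ((sigmaEquiv hq hb δ).apply_symm_apply _).symm.trans hpv.symm

variable (E) in
/-- `G'` arises from `G` by adding a nonzero vector that is reduced w.r.t. `G`. -/
def Augments (le : VMon n m → VMon n m → Prop) (G' G : Finset (Fin m → A)) : Prop :=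
  ∃ r, r ≠ 0 ∧ E.IsReduced le G r ∧ (G' : Set (Fin m → A)) = insert r (G : Set (Fin m → A))

-- In an infinite chain some added vector would have a normalised leading coefficient in the left
-- ideal of those of earlier vectors whose leading monomials divide its own, so it was not reduced.
include hq hb in
theorem wellFounded_augments [IsNoetherianRing R] {le₀ : Expo n → Expo n → Prop}
    (hle : E.IsVMonomialOrder le₀ le) : WellFounded (E.Augments le) := by
  rw [wellFounded_iff_isEmpty_descending_chain]
  refine ⟨fun ⟨G, hG⟩ => ?_⟩
  choose r hr0 hred hins using hG
  choose X hX using fun k => exists_isVLM hle (hr0 k)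
  have hmono : Monotone fun k => (G k : Set (Fin m → A)) :=
    monotone_nat_of_le_succ fun k => by rw [hins k]; exact Set.subset_insert _ _
  have hmem : ∀ j k, j < k → r j ∈ G k := fun j k hjk =>
    hmono (Nat.succ_le_of_lt hjk) (show r j ∈ (G (j + 1) : Set (Fin m → A)) by rw [hins j]; exact Set.mem_insert _ _)
  -- Dickson's lemma for exponents, combined with equality on the finite set of indices: this is
  -- divisibility of monomials of `A^m`.
  have hwqo : WellQuasiOrdered fun X Y : VMon n m => X.1 ≤ Y.1 ∧ X.2 = Y.2 :=
    WellQuasiOrdered.prod (wellQuasiOrdered_le (α := Expo n)) (Finite.wellQuasiOrdered (· = ·))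
  have : IsPreorder (VMon n m) fun X Y => X.1 ≤ Y.1 ∧ X.2 = Y.2 :=
    { refl := fun X => ⟨le_rfl, rfl⟩
      trans := fun X Y Z h h' => ⟨h.1.trans h'.1, h.2.trans h'.2⟩ }
  obtain ⟨φ, hφ⟩ := hwqo.exists_monotone_subseq X
  let l : ℕ → R := fun k => rightCoeff hq hb (r (φ k)) (X (φ k))
  let I : ℕ →o Ideal R :=
    ⟨fun k => Ideal.span (l '' Set.Iio k), fun a b hab =>
      Ideal.span_mono (Set.image_mono (Set.Iio_subset_Iio hab))⟩
  -- `I k` is generated by `l j` with `j < k`, so `I N = I (N + 1)` expresses `l N` by its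
  -- predecessors.
  obtain ⟨N, hN⟩ := monotone_stabilizes_iff_noetherian.2 ‹IsNoetherianRing R› I
  have hlN : l N ∈ I N := by
    rw [hN (N + 1) (Nat.le_succ N)]
    exact Ideal.subset_span ⟨N, Nat.lt_succ_self N, rfl⟩
  refine not_isReduced_of_rightCoeff_mem_span hq hb (hX (φ N)) _ ?_ hlN (hred (φ N))
  rintro _ ⟨j, hj, rfl⟩
  obtain ⟨h1, h2⟩ := hφ j N hj.le
  refine ⟨r (φ j), hmem _ _ (φ.strictMono hj), (X (φ j)).1, h1, ?_, ?_⟩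
  · rw [← h2]; exact hX _
  · rw [← h2]

variable (E) in
/-- The number of monomials up to the leading monomial of `h`. -/
noncomputable def height (le : VMon n m → VMon n m → Prop) (h : Fin m → A) : ℕ :=
  {Z | ∃ Y, E.vcoeff h Y ≠ 0 ∧ le Z Y}.ncard

variable {le₀ : Expo n → Expo n → Prop} (hle : E.IsVMonomialOrder le₀ le)
include hle

/-- The case `h' = 0` is covered: its height counts the empty set, while that of `h` counts at least
`X`. -/
theorem height_lt {h h' : Fin m → A} {X : VMon n m} (hX : E.IsVLM le h X)
    (hs : h' ∈ E.supported (SLT le · X)) : E.height le h' < E.height le h := by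
  refine Set.ncard_lt_ncard ⟨?_, fun hsub => ?_⟩ ((finite_setOf_le hle X).subset ?_)
  · rintro Z ⟨Y, hY, hZ⟩
    exact ⟨X, hX.1, hle.trans _ _ _ hZ (hs Y hY).1⟩
  · obtain ⟨Y, hY, hXY⟩ := hsub ⟨X, hX.1, hle.refl X⟩
    exact (hs Y hY).2 (hle.antisymm _ _ (hs Y hY).1 hXY)
  · rintro Z ⟨Y, hY, hZ⟩
    exact hle.trans _ _ _ hZ (hX.2 Y hY)

include hq hb

theorem ReducesStep.exists_sub (hle₀ : E.IsMonomialOrder le₀) [Nontrivial R] {h h' : Fin m → A}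
    (hred : ¬ E.IsReduced le G h) (hstep : E.ReducesStep le G h h') :
    ∃ X, E.IsVLM le h X ∧ h' ∈ E.supported (SLT le · X) ∧
      ∃ p ∈ E.filt le G (· = X), h' = h - p := by
  have h0 : h ≠ 0 := fun h0 => hred (Or.inl h0)
  obtain ⟨X, hX, p, hp, hv, rfl⟩ := (reducesStep_iff hq hb h0).1 hstep
  refine ⟨X, hX, mem_supported_slt (sub_mem (isVLM_iff.1 hX).1 ?_) ?_, p, hp, rfl⟩
  · exact filt_le_supported hq hb hle hle₀ (fun _ _ h h' => h' ▸ h) hp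
  · rw [vcoeff_sub, hv, sub_self]

omit hq hb hle

open scoped Classical in
variable (E) in
/-- The quantity that decreases lexicographically in each step of the algorithm. -/
noncomputable def rank (le : VMon n m → VMon n m → Prop) :
    State R n m → Finset (Fin m → A) × ℕ × ℕ × ℕ × ℕ
  | .test G G' => (G', if G = G' then 0 else 1, 0, 0, 0)
  | .sets G G' D => (G', if G = G' then 0 else 1, 2 * D.card + 1, 0, 0)
  | .vectors G G' D _ _ B => (G', if G = G' then 0 else 1, 2 * D.card + 2, 2 * B.card, 0)
  | .reducing G G' D _ _ B h =>
    (G', if G = G' then 0 else 1, 2 * D.card + 2, 2 * B.card + 1, E.height le h)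

variable (E) in
/-- The lexicographic order in which `rank` decreases. -/
def RankLT (le : VMon n m → VMon n m → Prop) :
    Finset (Fin m → A) × ℕ × ℕ × ℕ × ℕ → Finset (Fin m → A) × ℕ × ℕ × ℕ × ℕ → Prop :=
  Prod.Lex (E.Augments le)
    (Prod.Lex (· < ·) (Prod.Lex (· < ·) (Prod.Lex (· < ·) (· < ·))))

include hq hb hle

/-- Adding a remainder lowers the first component, whatever happens to the others. Entering the loop
turns the second from `1` to `0`. The factors `2` leave room for the inner loops: taking `S` out of
`D` gives `2(d-1)+2 < 2d+1`, and returning gives `2d+1 < 2d+2`; syzygies are counted in the same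
way. -/
theorem rank_step (hle₀ : E.IsMonomialOrder le₀) [Nontrivial R] {s s' : State R n m}
    (h : E.Step le s s') : E.RankLT le (E.rank le s') (E.rank le s) := by
  classical
  cases h with
  | enter G G' hne =>
    refine Prod.Lex.right _ ?_
    rw [if_pos rfl, if_neg (Ne.symm hne)]
    exact Prod.Lex.left _ _ one_pos
  | skip G G' D S hS hX =>
    refine Prod.Lex.right _ (Prod.Lex.right _ (Prod.Lex.left _ _ ?_))
    have := Finset.card_erase_lt_of_mem hS
    convert (by omega : 2 * (D.erase S).card + 1 < 2 * D.card + 1)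
  | compute G G' D S hS u β γ hX B hB =>
    refine Prod.Lex.right _ (Prod.Lex.right _ (Prod.Lex.left _ _ ?_))
    have := Finset.card_erase_lt_of_mem hS
    convert (by omega : 2 * (D.erase S).card + 2 < 2 * D.card + 1)
  | leave G G' =>
    exact Prod.Lex.right _ (Prod.Lex.right _ (Prod.Lex.left _ _ (by omega)))
  | choose G G' D S γ B b hb =>
    refine Prod.Lex.right _ (Prod.Lex.right _ (Prod.Lex.right _ (Prod.Lex.left _ _ ?_)))
    have := Finset.card_erase_lt_of_mem hb
    convert (by omega : 2 * (B.erase b).card + 1 < 2 * B.card)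
  | reduce G G' D S γ B h h' hred hstep =>
    refine Prod.Lex.right _ (Prod.Lex.right _ (Prod.Lex.right _ (Prod.Lex.right _ ?_)))
    obtain ⟨X, hX, hs, -⟩ := hstep.exists_sub hq hb hle hle₀ hred
    exact height_lt hle hX hs
  | discard G G' D S γ B =>
    exact Prod.Lex.right _ (Prod.Lex.right _ (Prod.Lex.right _ (Prod.Lex.left _ _ (by omega))))
  | add G G' D S γ B r hred hr =>
    exact Prod.Lex.left _ _ ⟨r, hr, hred, by simp⟩
  | next G G' D S γ =>
    exact Prod.Lex.right _ (Prod.Lex.right _ (Prod.Lex.left _ _ (by omega)))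

theorem wellFounded_step (hle₀ : E.IsMonomialOrder le₀) [Nontrivial R] [IsNoetherianRing R] :
    WellFounded fun s' s => E.Step le s s' := by
  have hwf : WellFounded (E.RankLT le) :=
    WellFounded.prod_lex (wellFounded_augments hq hb hle) (WellFounded.prod_lex wellFounded_lt
      (WellFounded.prod_lex wellFounded_lt (WellFounded.prod_lex wellFounded_lt wellFounded_lt)))
  exact Subrelation.wf (fun h => rank_step hq hb hle hle₀ h) (InvImage.wf (E.rank le) hwf)

end Termination

end Extension

/-! ### The loop invariant -/

namespace Extension

variable {A : Type*} [Ring A] {R : Subring A} {n m : ℕ} {E : Extension R n}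
  {le : VMon n m → VMon n m → Prop}

variable (E) in
/-- The part of the loop invariant that concerns the sets: `G'` consists of nonzero elements of
`⟨F⟩`, and all subsets of `G` outside of `D` are treated. -/
structure SetsInvariant (le : VMon n m → VMon n m → Prop) (F G G' : Finset (Fin m → A))
    (D : Set (Finset (Fin m → A))) : Prop where
  input_subset : F ⊆ G'
  subset : G ⊆ G'
  ne_zero : ∀ g ∈ G', g ≠ 0
  mem_span : ∀ g ∈ G', g ∈ Submodule.span A (F : Set (Fin m → A))
  subset_of_mem : ∀ S ∈ D, S ⊆ G
  treated : ∀ S ⊆ G, S ∉ D → E.Treated le G' S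

variable (E) in
/-- The part of the loop invariant that concerns the syzygies of `S`: all of them are combinations
of those in `B` and of syzygies whose S-vectors need no further treatment. -/
structure VectorsInvariant (le : VMon n m → VMon n m → Prop) (G' S : Finset (Fin m → A))
    (u : Fin m) (β γ : S → Expo n) (B : Set (S → R)) : Prop where
  lcmData : E.LcmData le S u β γ
  subset_syz : B ⊆ E.syz S u β γ
  syz_le : E.syz S u β γ ≤ Submodule.span R B ⊔
    (E.filt le G' (SLT le · (Finset.univ.sup β, u))).comap (E.sVectorLin S γ)

variable (E) in
/-- The loop invariant of the algorithm on the input `F`. -/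
def Invariant (le : VMon n m → VMon n m → Prop) (F : Finset (Fin m → A)) : State R n m → Prop
  | .test G G' => E.SetsInvariant le F G G' ∅
  | .sets G G' D => E.SetsInvariant le F G G' D
  | .vectors G G' D S γ B => E.SetsInvariant le F G G' (insert S D) ∧
      ∃ u β, E.VectorsInvariant le G' S u β γ B
  | .reducing G G' D S γ B h => E.SetsInvariant le F G G' (insert S D) ∧
      ∃ u β b, E.VectorsInvariant le G' S u β γ (insert b B) ∧
        h ∈ E.supported (SLT le · (Finset.univ.sup β, u)) ∧
        h ∈ Submodule.span A (F : Set (Fin m → A)) ∧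
        E.sVector S γ b - h ∈ E.filt le G' (SLT le · (Finset.univ.sup β, u))

theorem SetsInvariant.span_eq {F G G' : Finset (Fin m → A)} {D : Set (Finset (Fin m → A))}
    (h : E.SetsInvariant le F G G' D) :
    Submodule.span A (G' : Set (Fin m → A)) = Submodule.span A (F : Set (Fin m → A)) :=
  le_antisymm (Submodule.span_le.2 h.mem_span)
    (Submodule.span_mono (Finset.coe_subset.2 h.input_subset))

/-- A syzygy whose S-vector needs no further treatment can be dropped. -/
theorem VectorsInvariant.drop {G' G'' S : Finset (Fin m → A)} {u : Fin m} {β γ : S → Expo n}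
    {B : Set (S → R)} {b : S → R} (h : E.VectorsInvariant le G' S u β γ (insert b B))
    (hG : G' ⊆ G'')
    (hb : E.sVector S γ b ∈ E.filt le G'' (SLT le · (Finset.univ.sup β, u))) :
    E.VectorsInvariant le G'' S u β γ B where
  lcmData := h.lcmData
  subset_syz := (Set.subset_insert _ _).trans h.subset_syz
  syz_le := by
    refine h.syz_le.trans (sup_le ?_ ((Submodule.comap_mono
      (filt_mono hG fun _ h => h)).trans le_sup_right))
    -- The multiples of `b` move from the span to the preimage, which is a submodule; this is why
    -- treating generators of the syzygies suffices.
    rw [Submodule.span_insert]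
    refine sup_le (le_trans ?_ le_sup_right) le_sup_left
    rw [Submodule.span_singleton_le_iff_mem, Submodule.mem_comap, sVectorLin_apply]
    exact hb

variable {le₀ : Expo n → Expo n → Prop} (hle : E.IsVMonomialOrder le₀ le)
  {F : Finset (Fin m → A)}
include hle

omit hle in
theorem invariant_start (hF0 : ∀ f ∈ F, f ≠ 0) :
    E.Invariant le F (State.start R n F) where
  input_subset := subset_rfl
  subset := Finset.empty_subset _
  ne_zero := hF0
  mem_span _ hg := Submodule.subset_span hg
  subset_of_mem _ h := h.elim
  treated S hS _ := by
    obtain rfl := Finset.subset_empty.1 hS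
    intro u β γ _ b _
    simp [sVector]

theorem Invariant.step (hq : E.IsQuasiCommutative) (hb : E.IsBijective)
    (hle₀ : E.IsMonomialOrder le₀) [Nontrivial R] {s s' : State R n m}
    (hs : E.Invariant le F s) (h : E.Step le s s') : E.Invariant le F s' := by
  classical
  cases h with
  | enter G G' hne =>
    refine ⟨hs.input_subset, subset_rfl, hs.ne_zero, hs.mem_span, fun S hS => ?_,
      fun S hS hSD => hs.treated S ?_ (Set.notMem_empty _)⟩
    · exact Finset.mem_powerset.1 (Finset.mem_sdiff.1 (Finset.mem_coe.1 hS)).1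
    -- A subset of the new `G` outside `D` is a subset of the old `G`, hence already treated.
    · by_contra h
      exact hSD (by simp [hS, h])
  | skip G G' D S hS hX =>
    refine ⟨hs.input_subset, hs.subset, hs.ne_zero, hs.mem_span,
      fun T hT => hs.subset_of_mem T ?_, fun T hT hTD => ?_⟩
    · exact Finset.mem_of_mem_erase (Finset.mem_coe.1 hT)
    · by_cases hTS : T = S
      · exact hTS ▸ treated_of_not_lcmNeZero hX
      · exact hs.treated T hT fun h => hTD (by simpa [hTS] using h)
  | compute G G' D S hS u β γ hX B hB =>
    refine ⟨?_, u, β, hX, ?_, ?_⟩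
    · rwa [← Finset.coe_insert, Finset.insert_erase hS]
    · rw [← hB]; exact Submodule.subset_span
    · rw [hB]; exact le_sup_left
  | leave G G' =>
    have : E.SetsInvariant le F G G' _ := hs
    rwa [Finset.coe_empty] at this
  | choose G G' D S γ B b hbB =>
    obtain ⟨hs, u, β, hv⟩ := hs
    have hSG : S ⊆ G' := (hs.subset_of_mem S (Set.mem_insert _ _)).trans hs.subset
    have hf := sVector_mem_filt hSG hv.lcmData b
    refine ⟨hs, u, β, b, ?_, ?_, ?_, ?_⟩
    · rwa [← Finset.coe_insert, Finset.insert_erase hbB]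
    · exact mem_supported_slt (filt_le_supported hq hb hle hle₀ (fun _ _ h h' => h' ▸ h) hf)
        ((mem_syz_iff hq hb hv.lcmData b).1 (hv.subset_syz hbB))
    · rw [← hs.span_eq]
      exact filt_le_span _ hf
    · rw [sub_self]
      exact zero_mem _
  | reduce G G' D S γ B h h' hred hstep =>
    obtain ⟨hs, u, β, b, hv, hsupp, hspan, hsub⟩ := hs
    obtain ⟨X, hX, hsupp', p, hp, rfl⟩ := hstep.exists_sub hq hb hle hle₀ hred
    -- The leading monomial of `h` lies below `X_S`, so what a reduction subtracts is also a
    -- combination below `X_S`.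
    have hXS := hsupp X hX.1
    refine ⟨hs, u, β, b, hv,
      supported_mono (fun Y hY => slt_of_le_of_slt hle hY.1 hXS) hsupp', ?_, ?_⟩
    · refine sub_mem hspan ?_
      rw [← hs.span_eq]
      exact filt_le_span _ hp
    · rw [← sub_add]
      exact add_mem hsub (filt_mono subset_rfl (fun Y hY => hY ▸ hXS) hp)
  | discard G G' D S γ B =>
    obtain ⟨hs, u, β, b, hv, -, -, hsub⟩ := hs
    rw [sub_zero] at hsub
    exact ⟨hs, u, β, hv.drop subset_rfl hsub⟩
  | add G G' D S γ B r hred hr =>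
    obtain ⟨hs, u, β, b, hv, hsupp, hspan, hsub⟩ := hs
    have hins : G' ⊆ insert r G' := Finset.subset_insert _ _
    refine ⟨⟨hs.input_subset.trans hins, hs.subset.trans hins, fun g hg => ?_, fun g hg => ?_,
      hs.subset_of_mem, fun T hT hTD => (hs.treated T hT hTD).mono hins⟩, u, β, hv.drop hins ?_⟩
    · rcases Finset.mem_insert.1 hg with rfl | hg
      · exact hr
      · exact hs.ne_zero g hg
    · rcases Finset.mem_insert.1 hg with rfl | hg
      · exact hspan
      · exact hs.mem_span g hg
    -- The remainder is now an element of `G'` with leading monomial below `X_S`, so it may itself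
    -- be used to express the S-vector.
    · obtain ⟨X, hX⟩ := exists_isVLM hle hr
      have h1 := mem_filt_of_mem (P := (SLT le · (Finset.univ.sup β, u)))
        (Finset.mem_insert_self r G') hX (hsupp X hX.1)
      have h2 := add_mem (filt_mono hins (fun _ h => h) hsub) h1
      rwa [sub_add_cancel] at h2
  | next G G' D S γ =>
    obtain ⟨hs, u, β, hv⟩ := hs
    refine ⟨hs.input_subset, hs.subset, hs.ne_zero, hs.mem_span,
      fun T hT => hs.subset_of_mem T (Set.mem_insert_of_mem _ hT), fun T hT hTD => ?_⟩
    by_cases hTS : T = S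
    · subst hTS
      -- With no generators left, every syzygy of `S` lies in the preimage, which says that `S` is
      -- treated.
      refine treated_of_lcmData hle hv.lcmData fun b hb => ?_
      have := hv.syz_le hb
      rwa [Finset.coe_empty, Submodule.span_empty, bot_sup_eq, Submodule.mem_comap,
        sVectorLin_apply] at this
    · exact hs.treated T hT (by simp [hTS] at hTD ⊢; exact hTD)

omit hle in
/-- The algorithm can only stop at the condition of the loop. -/
theorem exists_eq_test_of_no_step [IsNoetherianRing R] {s : State R n m}
    (h : ∀ s', ¬ E.Step le s s') : ∃ G, s = .test G G := by
  cases s with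
  | test G G' =>
    by_cases hG : G' = G
    · exact ⟨G, by rw [hG]⟩
    · exact absurd (.enter G G' hG) (h _)
  | sets G G' D =>
    rcases D.eq_empty_or_nonempty with rfl | ⟨S, hS⟩
    · exact absurd (.leave G G') (h _)
    by_cases hX : E.LcmNeZero le S
    · obtain ⟨u, β, γ, hd⟩ := hX
      -- A finite `B_S` exists because the syzygies form a submodule of the Noetherian module `R^S`.
      obtain ⟨B, hB⟩ := IsNoetherian.noetherian (E.syz S u β γ)
      exact absurd (.compute G G' D S hS u β γ hd B hB) (h _)
    · exact absurd (.skip G G' D S hS hX) (h _)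
  | vectors G G' D S γ B =>
    rcases B.eq_empty_or_nonempty with rfl | ⟨b, hb⟩
    · exact absurd (.next G G' D S γ) (h _)
    · exact absurd (.choose G G' D S γ B b hb) (h _)
  | reducing G G' D S γ B f =>
    by_cases h0 : f = 0
    · subst h0
      exact absurd (.discard G G' D S γ B) (h _)
    by_cases hred : E.IsReduced le G' f
    · exact absurd (.add G G' D S γ B f hred h0) (h _)
    · obtain ⟨f', hf'⟩ := not_not.1 (not_or.1 hred).2
      exact absurd (.reduce G G' D S γ B f f' hred hf') (h _)

end Extension

end SkewPBW

/-! ### Correctness of the algorithm -/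

theorem corollary31 {A : Type*} [Ring A] (R : Subring A) [IsNoetherianRing R] {n m : ℕ}
    (E : SkewPBW.Extension R n) (hq : E.IsQuasiCommutative) (hb : E.IsBijective)
    (le₀ : SkewPBW.Expo n → SkewPBW.Expo n → Prop) (hle₀ : E.IsMonomialOrder le₀)
    (le : SkewPBW.VMon n m → SkewPBW.VMon n m → Prop) (hle : E.IsVMonomialOrder le₀ le)
    (F : Finset (Fin m → A)) (hF : F.Nonempty) (hF0 : ∀ f ∈ F, f ≠ 0) :
    -- every run of the algorithm on the input `F` is finite
    (¬ ∃ s : ℕ → SkewPBW.Extension.State R n m,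
      s 0 = SkewPBW.Extension.State.start R n F ∧ ∀ k, E.Step le (s k) (s (k + 1))) ∧
    -- a run can only stop by leaving the WHILE loop, and then with a Gröbner basis of `⟨F⟩`
    ∀ s : SkewPBW.Extension.State R n m,
      Relation.ReflTransGen (E.Step le) (SkewPBW.Extension.State.start R n F) s →
      (∀ s', ¬ E.Step le s s') →
      ∃ G : Finset (Fin m → A), s = SkewPBW.Extension.State.test G G ∧
        E.IsGroebnerBasis le (Submodule.span A (F : Set (Fin m → A))) G := by
  obtain ⟨f, hf⟩ := hF
  -- A nonzero input vector has a nonzero coefficient, so `R` is not the zero ring and units of `R`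
  -- are nonzero.
  have hR : Nontrivial R := by
    obtain ⟨X, hX⟩ := E.exists_vcoeff_ne_zero (hF0 f hf)
    exact ⟨_, _, hX⟩
  constructor
  · rintro ⟨s, -, hs⟩
    exact (wellFounded_iff_isEmpty_descending_chain.1
      (SkewPBW.Extension.wellFounded_step hq hb hle hle₀)).false ⟨s, hs⟩
  · intro s hs hend
    have hinv : E.Invariant le F s := by
      clear hend
      induction hs with
      | refl => exact SkewPBW.Extension.invariant_start hF0
      | tail _ hstep ih => exact ih.step hle hq hb hle₀ hstep
    obtain ⟨G, rfl⟩ := SkewPBW.Extension.exists_eq_test_of_no_step hend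
    have hG : E.SetsInvariant le F G G ∅ := hinv
    refine ⟨G, rfl, Or.inr ⟨fun hbot => hF0 f hf ?_, ⟨f, hG.input_subset hf⟩,
      fun g hg => ⟨hG.mem_span g hg, hG.ne_zero g hg⟩, fun h hh h0 => ?_⟩⟩
    · rw [← Submodule.mem_bot A, ← hbot]
      exact Submodule.subset_span hf
    · rw [← hG.span_eq] at hh
      exact SkewPBW.Extension.not_isReduced_of_treated hq hb hle hle₀
        (fun S hS => hG.treated S hS (Set.notMem_empty _)) hG.ne_zero hh h0
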